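/- Let $\mathbb F=\mathbb F_q$ be a finite field with $q$ elements, let $|\cdot|$ be the absolute value on $\mathbb F(T)$ with $|f/g|=q^{\deg f-\deg g}$, let $K_\infty=\mathbb F((T^{-1}))$ be the completion of $\mathbb F(T)$, and let $C_\infty$ be the completion of an algebraic closure of $K_\infty$ with respect to the unique extension of $|\cdot|$. An $\mathbb F$-lattice in $C_\infty$ is an $\mathbb F$-subspace $\Lambda\subset C_\infty$, of finite or infinite dimension, that is discrete in the sense that $\{\lambda\in\Lambda : |\lambda|\le r\}$ is finite for every real $r$. Its exponential function is $$e_\Lambda(X)=X\prod_{0\ne\lambda\in\Lambda}(1-X/\lambda)=\sum_{0\le i\le\dim_{\mathbb F}\Lambda}\alpha_i(\Lambda)X^{q^i}.$$ A successive minimum basis of $\Lambda$ is an ordered $\mathbb F$-basis $\lambda_1,\lambda_2,\dots$ of $\Lambda$, indexed by the integers $i$ with $1\le i\le\dim_{\mathbb F}\Lambda$, such that for each $i$ the value $|\lambda_i|$ is minimal among the $|\lambda|$ with $\lambda\in\Lambda$ outside the $\mathbb F$-span of $\lambda_1,\dots,\lambda_{i-1}$. Such bases exist, and the series $\operatorname{spec}(\Lambda)=(|\lambda_1|,|\lambda_2|,\dots)$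 depends only on $\Lambda$. For an integer $k$ with $1\le k<\dim_{\mathbb F}\Lambda$, the lattice $\Lambda$ is called $k$-inseparable if $|\lambda_k|=|\lambda_{k+1}|$. **Proposition 1.11.** Let $\Lambda$ be an $\mathbb F$-lattice in $C_\infty$. If $\alpha_k(\Lambda)=0$ for some $k<\dim_{\mathbb F}\Lambda$, then $\Lambda$ is $k$-inseparable. Conversely, if $\Lambda$ is $k$-inseparable, there exists an $\mathbb F$-lattice $\Lambda'$ in $C_\infty$ with $\operatorname{spec}(\Lambda')=\operatorname{spec}(\Lambda)$ and $\alpha_k(\Lambda')=0$. -/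

import Mathlib

/-- The absolute value at infinity on `F(T)`, normalized by `|T| = q` with `q = #F`:
`|f / g| = q ^ (deg f - deg g)`. -/
noncomputable def inftyAbs (F : Type*) [Field F] [Finite F] : AbsoluteValue (RatFunc F) ℝ where
  toFun r := open scoped Classical in if r = 0 then 0 else (Nat.card F : ℝ) ^ r.intDegree
  map_mul' x y := by
    have hq : (Nat.card F : ℝ) ≠ 0 := by exact_mod_cast Nat.card_pos.ne'
    by_cases hx : x = 0
    · simp [hx]
    by_cases hy : y = 0
    · simp [hy]
    simp [hx, hy, RatFunc.intDegree_mul hx hy, zpow_add₀ hq]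
  nonneg' x := by
    split_ifs <;> positivity
  eq_zero' x := by
    have hq : (Nat.card F : ℝ) ≠ 0 := by exact_mod_cast Nat.card_pos.ne'
    by_cases hx : x = 0
    · simp [hx]
    · simp [hx, zpow_ne_zero _ hq]
  add_le' x y := by
    have hq : (1 : ℝ) ≤ (Nat.card F : ℝ) := by exact_mod_cast Nat.card_pos
    by_cases hx : x = 0
    · subst hx
      split_ifs <;> simp_all
    by_cases hy : y = 0
    · subst hy
      split_ifs <;> simp_all
    by_cases hxy : x + y = 0
    · simp only [hxy, if_true]
      split_ifs <;> positivity
    simp only [hx, hy, hxy, if_false]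
    rcases le_max_iff.1 (RatFunc.intDegree_add_le hy hxy) with h | h
    · exact (zpow_le_zpow_right₀ hq h).trans (le_add_of_nonneg_right (by positivity))
    · exact (zpow_le_zpow_right₀ hq h).trans (le_add_of_nonneg_left (by positivity))

theorem inftyAbs_X (F : Type*) [Field F] [Finite F] :
    inftyAbs F RatFunc.X = Nat.card F := by
  change (open scoped Classical in if (RatFunc.X : RatFunc F) = 0 then (0 : ℝ)
    else (Nat.card F : ℝ) ^ (RatFunc.X : RatFunc F).intDegree) = _
  simp [RatFunc.X_ne_zero]

theorem inftyAbs_C (F : Type*) [Field F] [Finite F] {c : F} (hc : c ≠ 0) :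
    inftyAbs F (RatFunc.C c) = 1 := by
  change (open scoped Classical in if (RatFunc.C c : RatFunc F) = 0 then (0 : ℝ)
    else (Nat.card F : ℝ) ^ (RatFunc.C c : RatFunc F).intDegree) = _
  simp [hc]

theorem inftyAbs_add_le_max (F : Type*) [Field F] [Finite F] (x y : RatFunc F) :
    inftyAbs F (x + y) ≤ max (inftyAbs F x) (inftyAbs F y) := by
  have hq : (1 : ℝ) ≤ (Nat.card F : ℝ) := by exact_mod_cast Nat.card_pos
  by_cases hx : x = 0
  · simp [hx]
  by_cases hy : y = 0
  · simp [hy]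
  by_cases hxy : x + y = 0
  · rw [hxy, map_zero]
    exact le_max_of_le_left ((inftyAbs F).nonneg x)
  have e : ∀ z : RatFunc F, z ≠ 0 → inftyAbs F z = (Nat.card F : ℝ) ^ z.intDegree :=
    fun z hz => if_neg hz
  rw [e _ hx, e _ hy, e _ hxy]
  rcases le_max_iff.1 (RatFunc.intDegree_add_le hy hxy) with h | h
  · exact le_max_of_le_left (zpow_le_zpow_right₀ hq h)
  · exact le_max_of_le_right (zpow_le_zpow_right₀ hq h)

/-- `K_∞ = F((1/T))`, the completion of `F(T)` at the absolute value at infinity. -/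
def KInfty (F : Type*) [Field F] [Finite F] : Type _ := (inftyAbs F).Completion

namespace KInfty

variable (F : Type*) [Field F] [Finite F]

noncomputable instance : NormedField (KInfty F) :=
  inferInstanceAs (NormedField (inftyAbs F).Completion)

instance : CompleteSpace (KInfty F) :=
  inferInstanceAs (CompleteSpace (inftyAbs F).Completion)

/-- The embedding of `F(T)` into `K_∞`. -/
noncomputable def ofRatFunc : RatFunc F →+* KInfty F :=
  (UniformSpace.Completion.coeRingHom (α := WithAbs (inftyAbs F))).comp
    (WithAbs.equiv (inftyAbs F)).symm.toRingHom

theorem norm_ofRatFunc (r : RatFunc F) : ‖ofRatFunc F r‖ = inftyAbs F r :=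
  UniformSpace.Completion.norm_coe (E := WithAbs (inftyAbs F)) _

theorem denseRange_ofRatFunc : DenseRange (ofRatFunc F) :=
  (UniformSpace.Completion.denseRange_coe (α := WithAbs (inftyAbs F))).comp
    (WithAbs.equiv (inftyAbs F)).symm.surjective.denseRange
    (UniformSpace.Completion.continuous_coe _)

noncomputable instance : NontriviallyNormedField (KInfty F) where
  non_trivial := ⟨ofRatFunc F RatFunc.X, by
    rw [norm_ofRatFunc, inftyAbs_X]
    exact_mod_cast Finite.one_lt_card⟩

instance : IsUltrametricDist (KInfty F) :=
  IsUltrametricDist.isUltrametricDist_of_forall_norm_add_le_max_norm fun x y => by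
    refine (denseRange_ofRatFunc F).induction_on₂ (p := fun x y => ‖x + y‖ ≤ max ‖x‖ ‖y‖)
      (isClosed_le (by fun_prop) (by fun_prop)) (fun a b => ?_) x y
    rw [← map_add]
    simp only [norm_ofRatFunc]
    exact inftyAbs_add_le_max F a b

end KInfty

/-- An algebraic closure of `K_∞`, with the unique extension of the absolute value. -/
def KInftyAlg (F : Type*) [Field F] [Finite F] : Type _ := AlgebraicClosure (KInfty F)

namespace KInftyAlg

variable (F : Type*) [Field F] [Finite F]

noncomputable instance : Field (KInftyAlg F) := inferInstanceAs (Field (AlgebraicClosure (KInfty F)))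

noncomputable instance : Algebra (KInfty F) (KInftyAlg F) :=
  inferInstanceAs (Algebra (KInfty F) (AlgebraicClosure (KInfty F)))

instance : Algebra.IsAlgebraic (KInfty F) (KInftyAlg F) :=
  inferInstanceAs (Algebra.IsAlgebraic (KInfty F) (AlgebraicClosure (KInfty F)))

instance : IsAlgClosed (KInftyAlg F) :=
  inferInstanceAs (IsAlgClosed (AlgebraicClosure (KInfty F)))

noncomputable instance : NormedField (KInftyAlg F) := spectralNorm.normedField (KInfty F) (KInftyAlg F)

noncomputable instance : NormedAlgebra (KInfty F) (KInftyAlg F) :=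
  spectralNorm.normedAlgebra (KInfty F) (KInftyAlg F)

instance : IsUltrametricDist (KInftyAlg F) :=
  IsUltrametricDist.isUltrametricDist_of_forall_norm_add_le_max_norm
    (isNonarchimedean_spectralNorm (K := KInfty F) (L := KInftyAlg F))

end KInftyAlg

/-- `C_∞`, the completed algebraic closure of `K_∞`. -/
def CInfty (F : Type*) [Field F] [Finite F] : Type _ := UniformSpace.Completion (KInftyAlg F)

namespace CInfty

variable (F : Type*) [Field F] [Finite F]

noncomputable instance : NormedField (CInfty F) :=
  inferInstanceAs (NormedField (UniformSpace.Completion (KInftyAlg F)))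

instance : CompleteSpace (CInfty F) :=
  inferInstanceAs (CompleteSpace (UniformSpace.Completion (KInftyAlg F)))

/-- The embedding of the algebraic closure of `K_∞` into `C_∞`. -/
noncomputable def ofAlg : KInftyAlg F →+* CInfty F :=
  UniformSpace.Completion.coeRingHom (α := KInftyAlg F)

theorem norm_ofAlg (x : KInftyAlg F) : ‖ofAlg F x‖ = ‖x‖ :=
  UniformSpace.Completion.norm_coe (E := KInftyAlg F) x

theorem denseRange_ofAlg : DenseRange (ofAlg F) :=
  UniformSpace.Completion.denseRange_coe (α := KInftyAlg F)

/-- The embedding of the constant field `F` into `C_∞`. -/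
noncomputable def ofConst : F →+* CInfty F :=
  (ofAlg F).comp ((algebraMap (KInfty F) (KInftyAlg F)).comp
    ((KInfty.ofRatFunc F).comp RatFunc.C))

noncomputable instance : Algebra F (CInfty F) := (ofConst F).toAlgebra

theorem norm_ofConst {c : F} (hc : c ≠ 0) : ‖ofConst F c‖ = 1 := by
  rw [ofConst, RingHom.comp_apply, norm_ofAlg, RingHom.comp_apply, norm_algebraMap', RingHom.comp_apply,
    KInfty.norm_ofRatFunc, inftyAbs_C F hc]

instance : IsUltrametricDist (CInfty F) :=
  IsUltrametricDist.isUltrametricDist_of_forall_norm_add_le_max_norm fun x y => by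
    refine (denseRange_ofAlg F).induction_on₂ (p := fun x y => ‖x + y‖ ≤ max ‖x‖ ‖y‖)
      (isClosed_le (by fun_prop) (by fun_prop)) (fun a b => ?_) x y
    rw [← map_add]
    simp only [norm_ofAlg]
    exact IsUltrametricDist.norm_add_le_max a b

end CInfty


/-- An `F`-lattice in `C_∞`: an `F`-subspace that is discrete in the sense that it has only
finitely many elements in each ball of finite radius. -/
structure FLattice (F : Type*) [Field F] [Finite F] where
  /-- The underlying subspace. -/
  toSubmodule : Submodule F (CInfty F)
  finite_ball : ∀ r : ℝ, {x : CInfty F | x ∈ toSubmodule ∧ ‖x‖ ≤ r}.Finite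

namespace FLattice

variable {F : Type*} [Field F] [Finite F]

/-- The dimension of `Λ` over `F`, possibly infinite. -/
noncomputable def dim (Λ : FLattice F) : ℕ∞ := Cardinal.toENat (Module.rank F Λ.toSubmodule)

/-- The positions `1 ≤ i ≤ dim Λ` in a successive minimum basis. -/
abbrev Idx (Λ : FLattice F) : Type := {i : ℕ // 1 ≤ i ∧ (i : ℕ∞) ≤ Λ.dim}

/-- A basis `λ₁, λ₂, …` of `Λ` is a successive minimum basis if for each `i` the absolute value
`|λᵢ|` is minimal among the `|x|` with `x ∈ Λ` outside the span of `λ₁, …, λᵢ₋₁`. -/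
def IsSMB (Λ : FLattice F) (b : Module.Basis Λ.Idx F Λ.toSubmodule) : Prop :=
  ∀ i : Λ.Idx, ∀ x : Λ.toSubmodule, x ∉ Submodule.span F (b '' Set.Iio i) →
    ‖(b i : CInfty F)‖ ≤ ‖(x : CInfty F)‖

theorem exists_isSMB (Λ : FLattice F) : ∃ b, Λ.IsSMB b := by
  have hmin : ∀ W : Submodule F Λ.toSubmodule, ∃ x : Λ.toSubmodule, W ≠ ⊤ →
      x ∉ W ∧ ∀ y, y ∉ W → ‖(x : CInfty F)‖ ≤ ‖(y : CInfty F)‖ := by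
    intro W
    by_cases hW : W = ⊤
    · exact ⟨0, fun h => (h hW).elim⟩
    obtain ⟨y₀, hy₀⟩ : ∃ y, y ∉ W := by
      by_contra! h
      exact hW (eq_top_iff.2 fun x _ => h x)
    have hfin : {y : Λ.toSubmodule | y ∉ W ∧ ‖(y : CInfty F)‖ ≤ ‖(y₀ : CInfty F)‖}.Finite := by
      refine Set.Finite.of_finite_image ((Λ.finite_ball ‖(y₀ : CInfty F)‖).subset ?_)
        (f := ((↑) : Λ.toSubmodule → CInfty F)) Subtype.val_injective.injOn
      rintro _ ⟨y, hy, rfl⟩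
      exact ⟨y.2, hy.2⟩
    obtain ⟨x, hx, hx'⟩ := Set.exists_min_image _ (fun y : Λ.toSubmodule => ‖(y : CInfty F)‖)
      hfin ⟨y₀, hy₀, le_rfl⟩
    refine ⟨x, fun _ => ⟨hx.1, fun y hy => ?_⟩⟩
    rcases le_total ‖(y : CInfty F)‖ ‖(y₀ : CInfty F)‖ with h | h
    · exact hx' y ⟨hy, h⟩
    · exact hx.2.trans h
  choose f hf using hmin
  let W : ℕ → Submodule F Λ.toSubmodule :=
    fun n => Nat.rec (⊥ : Submodule F Λ.toSubmodule) (fun _ V => V ⊔ Submodule.span F {f V}) n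
  let x : ℕ → Λ.toSubmodule := fun n => f (W n)
  have hWs : ∀ n, W n = Submodule.span F (x '' Set.Iio n) := by
    intro n
    induction n with
    | zero => simp [W]
    | succ n ih =>
      have h1 : Set.Iio (n + 1) = insert n (Set.Iio n) := by
        ext; simp
      rw [h1, Set.image_insert_eq, Submodule.span_insert, ← ih, sup_comm]
  have hrank : ∀ n : ℕ, Module.rank F (Submodule.span F (x '' Set.Iio n)) ≤ (n : Cardinal) := by
    classical
    intro n
    have h1 : x '' Set.Iio n = ((Finset.range n).image x : Finset _) := by
      ext; simp
    rw [h1]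
    refine (rank_span_finset_le _).trans ?_
    exact_mod_cast Finset.card_image_le.trans (Finset.card_range n).le
  have hne : ∀ n : ℕ, (n : ℕ∞) < Λ.dim → W n ≠ ⊤ := by
    intro n hn h
    have := hrank n
    rw [← hWs, h, rank_top] at this
    have h2 := Cardinal.toENat.monotone' this
    simp only [dim] at hn
    exact absurd (hn.trans_le h2) (by simp)
  have hli : ∀ n : ℕ, (n : ℕ∞) ≤ Λ.dim → LinearIndepOn F x (Set.Iio n) := by
    intro n
    induction n with
    | zero => intro _; simp
    | succ n ih =>
      intro hn
      have hn' : (n : ℕ∞) < Λ.dim := lt_of_lt_of_le (by exact_mod_cast Nat.lt_succ_self n) hn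
      have h1 : Set.Iio (n + 1) = insert n (Set.Iio n) := by
        ext; simp
      rw [h1]
      refine (ih hn'.le).insert ?_
      rw [← hWs]
      exact (hf _ (hne n hn')).1
  have hli' : LinearIndepOn F x {n : ℕ | (n : ℕ∞) < Λ.dim} := by
    rw [linearIndepOn_iff_linearIndepOn_finset]
    intro s hs
    rcases s.eq_empty_or_nonempty with rfl | hne
    · simp
    · refine (hli (s.max' hne + 1) ?_).mono fun i hi => ?_
      · have := hs (s.max'_mem hne)
        simp only [Set.mem_ofPred_eq] at this
        exact_mod_cast Order.add_one_le_of_lt this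
      · exact Nat.lt_succ_of_le (s.le_max' i hi)
  let e : Λ.Idx → {n : ℕ | (n : ℕ∞) < Λ.dim} := fun i => ⟨i.1 - 1, by
    obtain ⟨i, h1, h2⟩ := i
    refine lt_of_lt_of_le ?_ h2
    simp only
    exact_mod_cast Nat.sub_lt h1 one_pos⟩
  have he : Function.Injective e := by
    rintro ⟨i, hi, _⟩ ⟨j, hj, _⟩ h
    have h' : i - 1 = j - 1 := congrArg (fun t => t.1) h
    exact Subtype.ext (show i = j by omega)
  let v : Λ.Idx → Λ.toSubmodule := fun i => x (i.1 - 1)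
  have hv : LinearIndependent F v := LinearIndependent.comp hli' e he
  have himg : ∀ i : Λ.Idx, v '' Set.Iio i = x '' Set.Iio (i.1 - 1) := by
    intro i
    ext y
    constructor
    · rintro ⟨j, hj, rfl⟩
      have hj : j.1 < i.1 := hj
      have := j.2.1
      exact ⟨j.1 - 1, by simp only [Set.mem_Iio]; omega, rfl⟩
    · rintro ⟨j, hj, rfl⟩
      have hj : j < i.1 - 1 := hj
      refine ⟨⟨j + 1, by omega, le_trans ?_ i.2.2⟩, ?_, rfl⟩
      · exact_mod_cast (show j + 1 ≤ i.1 by omega)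
      · exact (show j + 1 < i.1 by omega)
  have hspan : ⊤ ≤ Submodule.span F (Set.range v) := by
    intro y _
    by_contra hy
    have hyW : ∀ n : ℕ, (n : ℕ∞) ≤ Λ.dim → y ∉ W n := by
      intro n hn h
      refine hy (Submodule.span_mono ?_ (hWs n ▸ h))
      rintro _ ⟨j, hj, rfl⟩
      have hj : j < n := hj
      exact ⟨⟨j + 1, by omega, le_trans (by exact_mod_cast hj) hn⟩, rfl⟩
    rcases eq_or_ne Λ.dim ⊤ with htop | htop
    · have hinj : Function.Injective x := by
        have h : LinearIndepOn F x Set.univ := by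
          simpa [htop] using hli'
        exact (linearIndepOn_univ_iff.1 h).injective
      have hsub : Set.range (fun n => (x n : CInfty F)) ⊆
          {z : CInfty F | z ∈ Λ.toSubmodule ∧ ‖z‖ ≤ ‖(y : CInfty F)‖} := by
        rintro _ ⟨n, rfl⟩
        have hn : (n : ℕ∞) < Λ.dim := htop ▸ ENat.natCast_lt_top n
        exact ⟨(x n).2, (hf _ (hne n hn)).2 y (hyW n hn.le)⟩
      exact Set.infinite_range_of_injective (Subtype.val_injective.comp hinj)
        ((Λ.finite_ball _).subset hsub)
    · obtain ⟨d, hd⟩ := ENat.ne_top_iff_exists.1 htop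
      have hyd := hyW d hd.le
      have hins := (hli d hd.le).insert (x := d)
      have hlt : W d < W d ⊔ Submodule.span F {y} := by
        refine lt_of_le_of_ne le_sup_left fun h => hyd ?_
        rw [h]
        exact Submodule.mem_sup_right (Submodule.mem_span_singleton_self y)
      have hrk : Module.rank F Λ.toSubmodule = d := by
        have : Cardinal.toENat (Module.rank F Λ.toSubmodule) = (d : ℕ∞) := hd.symm
        simpa using this
      have hWd : W d = ⊤ := by
        have : Module.Finite F Λ.toSubmodule :=
          Module.rank_lt_aleph0_iff.1 (hrk ▸ Cardinal.natCast_lt_aleph0)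
        apply Submodule.eq_top_of_finrank_eq
        have h1 := finrank_span_eq_card (hli d hd.le)
        rw [hWs, Module.finrank_eq_of_rank_eq hrk]
        rw [Set.image_eq_range]
        simpa using h1
      exact hyd (hWd ▸ Submodule.mem_top)
  refine ⟨Module.Basis.mk hv hspan, fun i y hy => ?_⟩
  rw [Module.Basis.coe_mk, himg, ← hWs] at hy
  rw [Module.Basis.mk_apply]
  exact (hf _ fun h => hy (by rw [h]; exact Submodule.mem_top)).2 y hy

/-- The absolute values along a successive minimum basis are non-decreasing. -/
theorem IsSMB.monotone {Λ : FLattice F} {b : Module.Basis Λ.Idx F Λ.toSubmodule}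
    (hb : Λ.IsSMB b) {i j : Λ.Idx} (hij : i ≤ j) :
    ‖(b i : CInfty F)‖ ≤ ‖(b j : CInfty F)‖ :=
  hb i (b j) (b.linearIndependent.notMem_span_image (not_lt.2 hij))

/-- The absolute values along a successive minimum basis do not depend on the basis. -/
theorem IsSMB.norm_eq {Λ : FLattice F} {b b' : Module.Basis Λ.Idx F Λ.toSubmodule}
    (hb : Λ.IsSMB b) (hb' : Λ.IsSMB b') (i : Λ.Idx) :
    ‖(b i : CInfty F)‖ = ‖(b' i : CInfty F)‖ := by
  have key : ∀ {b b' : Module.Basis Λ.Idx F Λ.toSubmodule}, Λ.IsSMB b → Λ.IsSMB b' →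
      ‖(b i : CInfty F)‖ ≤ ‖(b' i : CInfty F)‖ := by
    intro b b' hb hb'
    by_contra! hlt
    have hle : Submodule.span F (b' '' Set.Iic i) ≤ Submodule.span F (b '' Set.Iio i) := by
      rw [Submodule.span_le]
      rintro _ ⟨j, hj, rfl⟩
      by_contra h
      exact absurd ((hb i _ h).trans (hb'.monotone hj)) (not_le.2 hlt)
    have hfin : (Set.Iic i).Finite :=
      Set.Finite.of_finite_image (f := Subtype.val)
        ((Set.finite_Iic i.1).subset (by rintro _ ⟨j, hj, rfl⟩; exact hj))
        Subtype.val_injective.injOn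
    have hfin' : (Set.Iio i).Finite := hfin.subset Set.Iio_subset_Iic_self
    have : Finite (b '' Set.Iio i) := hfin'.image _
    have hr := Submodule.rank_mono hle
    rw [rank_span_set ((b'.linearIndependent.linearIndepOn (Set.Iic i)).id_image),
      rank_span_set ((b.linearIndependent.linearIndepOn (Set.Iio i)).id_image)] at hr
    have h1 : (b' '' Set.Iic i).ncard ≤ (b '' Set.Iio i).ncard :=
      Cardinal.toNat_le_toNat hr Cardinal.mk_lt_aleph0
    rw [Set.ncard_image_of_injective _ b'.injective, Set.ncard_image_of_injective _ b.injective]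
      at h1
    have h2 := Set.ncard_lt_ncard (Set.Iio_ssubset_Iic_self (a := i)) hfin
    omega
  exact le_antisymm (key hb hb') (key hb' hb)

/-- The spectrum `|λ₁|, |λ₂|, …` of `Λ`, where `λ₁, λ₂, …` is a successive minimum basis of `Λ`.
It does not depend on the choice of that basis. The entries at the positions `1 ≤ i ≤ dim Λ` are
positive; at all other positions the value `0` is assigned, which marks the end of the series. -/
noncomputable def spec (Λ : FLattice F) (i : ℕ) : ℝ :=
  open scoped Classical in
  if h : 1 ≤ i ∧ (i : ℕ∞) ≤ Λ.dim then ‖(Λ.exists_isSMB.choose ⟨i, h⟩ : CInfty F)‖ else 0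

theorem IsSMB.spec_eq {Λ : FLattice F} {b : Module.Basis Λ.Idx F Λ.toSubmodule}
    (hb : Λ.IsSMB b) (i : Λ.Idx) : Λ.spec i.1 = ‖(b i : CInfty F)‖ := by
  rw [spec, dif_pos i.2]
  exact Λ.exists_isSMB.choose_spec.norm_eq hb i

/-- `Λ` is `k`-inseparable if `|λ_k| = |λ_{k+1}|`; both basis vectors have to exist, so that
`1 ≤ k < dim Λ`. -/
def IsInseparable (Λ : FLattice F) (k : ℕ) : Prop :=
  1 ≤ k ∧ (k : ℕ∞) < Λ.dim ∧ Λ.spec k = Λ.spec (k + 1)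

/-- Isospectral lattices: `spec Λ = spec Λ'`, including the lengths of the two series. -/
def Isospectral (Λ Λ' : FLattice F) : Prop :=
  Λ.spec = Λ'.spec

theorem Isospectral.dim_eq {Λ Λ' : FLattice F} (h : Λ.Isospectral Λ') : Λ.dim = Λ'.dim := by
  have pos : ∀ (Λ : FLattice F) (i : ℕ), 1 ≤ i → ((i : ℕ∞) ≤ Λ.dim ↔ Λ.spec i ≠ 0) := by
    intro Λ i hi
    constructor
    · intro hd
      rw [spec, dif_pos ⟨hi, hd⟩]
      simpa using Λ.exists_isSMB.choose.ne_zero _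
    · intro hs
      by_contra hd
      exact hs (by rw [spec, dif_neg (by tauto)])
  refine ENat.eq_of_forall_natCast_le_iff fun n => ?_
  rcases Nat.eq_zero_or_pos n with rfl | hn
  · simp
  · rw [pos Λ n hn, pos Λ' n hn, show Λ.spec = Λ'.spec from h]

open scoped PowerSeries.WithPiTopology in
/-- The exponential function `e_Λ(X) = X ∏' (1 - X / λ)`, the product being over the nonzero
elements `λ` of `Λ`, as a power series in `X`. Convergence is coefficientwise, with respect to the
absolute value of `C_∞`. -/
noncomputable def exp (Λ : FLattice F) : PowerSeries (CInfty F) :=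
  PowerSeries.X * ∏' l : {l : CInfty F // l ∈ Λ.toSubmodule ∧ l ≠ 0},
    (1 - PowerSeries.C (l : CInfty F)⁻¹ * PowerSeries.X)

open scoped PowerSeries.WithPiTopology in
/-- The product that defines `e_Λ` converges. -/
theorem multipliable_exp (Λ : FLattice F) :
    Multipliable fun l : {l : CInfty F // l ∈ Λ.toSubmodule ∧ l ≠ 0} =>
      (1 - PowerSeries.C (l : CInfty F)⁻¹ * PowerSeries.X) := by
  set a : {l : CInfty F // l ∈ Λ.toSubmodule ∧ l ≠ 0} → CInfty F := fun l => (l : CInfty F)⁻¹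
    with ha
  set P : Finset {l : CInfty F // l ∈ Λ.toSubmodule ∧ l ≠ 0} → PowerSeries (CInfty F) :=
    fun S => ∏ l ∈ S, (1 - PowerSeries.C (a l) * PowerSeries.X) with hP
  have hcoeff : ∀ (r : ℝ), 0 ≤ r → ∀ S, (∀ l ∈ S, ‖a l‖ ≤ r) → ∀ m,
      ‖PowerSeries.coeff m (P S)‖ ≤ r ^ m := by
    classical
    intro r hr S
    induction S using Finset.induction_on with
    | empty =>
      intro _ m
      rcases Nat.eq_zero_or_pos m with rfl | hm
      · simp [hP]
      · simp [hP, PowerSeries.coeff_one, hm.ne', pow_nonneg hr]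
    | insert l S hl ih =>
      intro h m
      have ih' := ih fun l' hl' => h l' (Finset.mem_insert_of_mem hl')
      have e : P (insert l S) = P S - PowerSeries.X * (PowerSeries.C (a l) * P S) := by
        simp only [hP, Finset.prod_insert hl]
        ring
      rw [e, map_sub]
      cases m with
      | zero => simpa using ih' 0
      | succ m =>
        rw [PowerSeries.coeff_succ_X_mul, PowerSeries.coeff_C_mul]
        rw [sub_eq_add_neg]
        refine (IsUltrametricDist.norm_add_le_max _ _).trans (max_le (ih' _) ?_)
        rw [norm_neg, norm_mul, pow_succ']
        exact mul_le_mul (h l (Finset.mem_insert_self _ _)) (ih' m) (norm_nonneg _) hr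
  have hsmall : ∀ δ : ℝ, 0 < δ → {l | δ < ‖a l‖}.Finite := by
    intro δ hδ
    refine Set.Finite.of_finite_image ((Λ.finite_ball δ⁻¹).subset ?_)
      (f := Subtype.val) Subtype.val_injective.injOn
    rintro _ ⟨l, hl, rfl⟩
    refine ⟨l.2.1, ?_⟩
    have hl : δ < ‖a l‖ := hl
    rw [ha] at hl
    simp only [norm_inv] at hl
    exact (le_inv_comm₀ hδ (norm_pos_iff.2 l.2.2)).1 hl.le
  obtain ⟨R, hR1, hR⟩ : ∃ R : ℝ, 1 ≤ R ∧ ∀ l, ‖a l‖ ≤ R := by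
    obtain ⟨M, hM⟩ := ((hsmall 1 one_pos).image fun l => ‖a l‖).bddAbove
    refine ⟨max 1 M, le_max_left _ _, fun l => ?_⟩
    rcases le_or_gt ‖a l‖ 1 with h | h
    · exact h.trans (le_max_left _ _)
    · exact (hM ⟨l, h, rfl⟩).trans (le_max_right _ _)
  have hcau : ∀ m, CauchySeq fun S => PowerSeries.coeff m (P S) := by
    classical
    intro m
    rw [Metric.cauchySeq_iff']
    intro ε hε
    have hRm : 0 < R ^ m := by positivity
    set δ : ℝ := min 1 (ε / (2 * R ^ m)) with hδdef
    have hδ : 0 < δ := by positivity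
    refine ⟨(hsmall δ hδ).toFinset, fun S hS => ?_⟩
    set S₀ := (hsmall δ hδ).toFinset
    have hD : ∀ l ∈ S \ S₀, ‖a l‖ ≤ δ := by
      intro l hl
      by_contra! h
      exact (Finset.mem_sdiff.1 hl).2 (by simpa [S₀] using h)
    have e : P S - P S₀ = P S₀ * (P (S \ S₀) - 1) := by
      have : P S = P (S \ S₀) * P S₀ := (Finset.prod_sdiff hS).symm
      rw [this]
      ring
    have hbound : ‖PowerSeries.coeff m (P S) - PowerSeries.coeff m (P S₀)‖ ≤ R ^ m * δ := by
      rw [← map_sub, e, PowerSeries.coeff_mul]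
      refine IsUltrametricDist.norm_sum_le_of_forall_le_of_nonneg (by positivity) ?_
      rintro ⟨i, j⟩ hij
      have hij : i + j = m := by simpa using hij
      rw [norm_mul]
      refine mul_le_mul ?_ ?_ (norm_nonneg _) hRm.le
      · exact (hcoeff R (by positivity) S₀ (fun l _ => hR l) i).trans
          (pow_le_pow_right₀ hR1 (by omega))
      · rcases Nat.eq_zero_or_pos j with rfl | hj
        · have h0 : PowerSeries.coeff 0 (P (S \ S₀) - 1) = 0 := by
            simp [hP, map_prod]
          simp only [h0, norm_zero]
          exact hδ.le
        · rw [map_sub, PowerSeries.coeff_one, if_neg hj.ne', sub_zero]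
          refine (hcoeff δ hδ.le _ hD j).trans ?_
          exact pow_le_of_le_one hδ.le (min_le_left _ _) hj.ne'
    rw [dist_eq_norm]
    refine hbound.trans_lt ?_
    have : R ^ m * δ ≤ R ^ m * (ε / (2 * R ^ m)) := by
      gcongr
      exact min_le_right _ _
    have h2 : R ^ m * (ε / (2 * R ^ m)) = ε / 2 := by field_simp
    linarith
  choose c hc using fun m => cauchySeq_tendsto_of_complete (hcau m)
  refine ⟨PowerSeries.mk c, ?_⟩
  rw [HasProd, SummationFilter.unconditional_filter,
    PowerSeries.WithPiTopology.tendsto_iff_coeff_tendsto]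
  intro m
  simpa using hc m

/-- `α_k(Λ)`, the coefficient of `X ^ (q ^ k)` in `e_Λ`. -/
noncomputable def alpha (Λ : FLattice F) (k : ℕ) : CInfty F :=
  PowerSeries.coeff (Nat.card F ^ k) Λ.exp

end FLattice

/-!
Write `q = #F`, and let `M` be the Gauss norm `max ‖αᵢ(V)‖ r ^ (q ^ i)` of the exponential function
of a lattice `V` at a radius `r` (`FLattice.gaussNorm`). Up to sign, `αⱼ(V)` is an elementary
symmetric function of degree `q ^ j - 1` in the inverses of the nonzero elements of `V`. If exactly
`q ^ j` elements of `V` have absolute value at most `r`, the product of the inverses of those other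
than `0` dominates all other terms, so that `‖αⱼ(V)‖ r ^ (q ^ j) = M` (`FLattice.norm_alpha_eq`) and
`αⱼ(V) ≠ 0`. If `‖λ_k‖ < ‖λ_{k+1}‖`, this applies to `Λ` with `j = k` and `r = ‖λ_k‖`, and
gives the first implication.

For the converse, an isospectral lattice is built by exchanging the basis elements of absolute value
`r = ‖λ_k‖ = ‖λ_{k+1}‖` from `λ_k` on, one at a time. The tools are the following.

* Adjoining `x` to a lattice `V` gives `e_{V + F x} = e_V - e_V ^ q / e_V(x) ^ (q - 1)`, whence
  `αᵢ(V + F x) = αᵢ(V) - αᵢ₋₁(V) ^ q / e_V(x) ^ (q - 1)` (`expPoly_sup_span_singleton`,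
  `FLattice.alpha_adjoin`).
* The value `w = e_V(x)` can be prescribed: if `‖w‖ = M`, then `e_V(x) = w` has a solution with
  `‖x‖ ≤ r`, and every such `x` automatically has absolute value and distance from `V` equal to `r`
  (`CInfty.IsEntire.exists_linSeries_eq`, `FLattice.exists_adjoin`). So adjoining `x` inserts
  one more `r` into the spectrum; this is recorded by orthogonal families
  (`FLattice.IsOrthogonalOn`).

Put `k = l + 1`. The span of the basis elements that are kept has exactly `q ^ l` elements of
absolute value at most `r`, hence its Gauss norm is attained at the term of index `l`. Adjoining
generic elements preserves this, and makes the term of index `k` attain the Gauss norm as well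
(`FLattice.exists_generic_adjoin`). The last element is chosen with
`e_V(x) ^ (q - 1) = α_l(V) ^ q / α_k(V)`, whose absolute value is `M ^ (q - 1)`, as it has to be;
then `α_k(V + F x) = 0` (`FLattice.exists_adjoin_alpha_eq_zero`).
-/

open Polynomial Filter Topology

/-! ### Newton polygon estimates -/

/-- `X ∏ (1 - X / l)`, the product being over a finite set `S` of elements `l`. If `S` is the set
of nonzero elements of a finite lattice, this is its exponential function. -/
noncomputable def expPoly {K : Type*} [Field K] (S : Finset K) : K[X] :=
  X * ∏ l ∈ S, (1 - C l⁻¹ * X)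

section ExpPoly

variable {K : Type*} [Field K]

theorem coeff_zero_mul_one_sub (f : K[X]) (a : K) :
    (f * (1 - C a * X)).coeff 0 = f.coeff 0 := by
  simp [mul_sub]

theorem coeff_succ_mul_one_sub (f : K[X]) (a : K) (m : ℕ) :
    (f * (1 - C a * X)).coeff (m + 1) = f.coeff (m + 1) - a * f.coeff m := by
  have : f * (1 - C a * X) = f - C a * (f * X) := by ring
  rw [this, coeff_sub, coeff_C_mul, coeff_mul_X]

theorem expPoly_insert [DecidableEq K] {S : Finset K} {l : K} (hl : l ∉ S) :
    expPoly (insert l S) = expPoly S * (1 - C l⁻¹ * X) := by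
  rw [expPoly, expPoly, Finset.prod_insert hl]
  ring

theorem coeff_zero_expPoly (S : Finset K) : (expPoly S).coeff 0 = 0 := by
  simp [expPoly]

theorem coeff_one_expPoly (S : Finset K) : (expPoly S).coeff 1 = 1 := by
  rw [expPoly, coeff_X_mul, coeff_zero_eq_eval_zero, eval_prod]
  simp

theorem eval_expPoly (S : Finset K) (x : K) :
    (expPoly S).eval x = x * ∏ l ∈ S, (1 - l⁻¹ * x) := by
  simp [expPoly, eval_prod]

theorem eval_expPoly_eq_zero_iff (S : Finset K) (hS : (0 : K) ∉ S) (x : K) :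
    (expPoly S).eval x = 0 ↔ x = 0 ∨ x ∈ S := by
  rw [eval_expPoly, mul_eq_zero, Finset.prod_eq_zero_iff]
  refine or_congr_right ⟨?_, fun h => ⟨x, h, ?_⟩⟩
  · rintro ⟨l, hl, h⟩
    have hl0 : l ≠ 0 := fun h0 => hS (h0 ▸ hl)
    have : x = l := by
      field_simp at h
      linear_combination -h
    exact this ▸ hl
  · rw [inv_mul_cancel₀ (fun h0 => hS (h0 ▸ h)), sub_self]

theorem natDegree_expPoly_le (S : Finset K) : (expPoly S).natDegree ≤ S.card + 1 := by
  have h1 : ∀ l ∈ S, (1 - C l⁻¹ * X : K[X]).natDegree ≤ 1 := fun l _ => by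
    refine (natDegree_sub_le _ _).trans (max_le (by simp) ((natDegree_C_mul_le _ _).trans natDegree_X_le))
  have h2 : (∏ l ∈ S, (1 - C l⁻¹ * X : K[X])).natDegree ≤ S.card := by
    refine (natDegree_prod_le _ _).trans ((Finset.sum_le_sum h1).trans ?_)
    simp
  refine natDegree_mul_le.trans ?_
  have := natDegree_X_le (R := K)
  omega

/-- `expPoly S` is determined by its zeros, its degree and its linear term. -/
theorem eq_expPoly {S : Finset K} (hS : (0 : K) ∉ S) {f : K[X]} (hdeg : f.natDegree ≤ S.card + 1)
    (h0 : f.coeff 0 = 0) (h1 : f.coeff 1 = 1) (hroot : ∀ l ∈ S, f.eval l = 0) :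
    f = expPoly S := by
  rw [← sub_eq_zero]
  have hdvd : X ^ 2 ∣ f - expPoly S := by
    rw [X_pow_dvd_iff]
    intro d hd
    interval_cases d
    · rw [coeff_sub, h0, coeff_zero_expPoly, sub_zero]
    · rw [coeff_sub, h1, coeff_one_expPoly, sub_self]
  obtain ⟨g, hg⟩ := hdvd
  rw [hg]
  by_cases hg0 : g = 0
  · simp [hg0]
  have hdeg' : g.natDegree < S.card := by
    have h2 : (f - expPoly S).natDegree ≤ S.card + 1 :=
      (natDegree_sub_le _ _).trans (max_le hdeg (natDegree_expPoly_le S))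
    rw [hg, natDegree_mul (by simp) hg0, natDegree_X_pow] at h2
    omega
  refine absurd (eq_zero_of_natDegree_lt_card_of_eval_eq_zero' g S (fun l hl => ?_) hdeg') hg0
  have hl0 : l ≠ 0 := fun h => hS (h ▸ hl)
  have h3 : (f - expPoly S).eval l = 0 := by
    rw [eval_sub, hroot l hl, (eval_expPoly_eq_zero_iff S hS l).2 (Or.inr hl), sub_self]
  rw [hg, eval_mul, eval_pow, eval_X] at h3
  exact (mul_eq_zero.1 h3).resolve_left (pow_ne_zero 2 hl0)

end ExpPoly

/-- If all elements of `S` have norm at most `r`, then the Gauss norm of `expPoly S` is attained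
at the leading coefficient. -/
theorem norm_leadingCoeff_expPoly {K : Type*} [NormedField K] {r : ℝ} {S : Finset K} (hS : ∀ l ∈ S, 0 < ‖l‖ ∧ ‖l‖ ≤ r) :
    ‖(expPoly S).coeff (S.card + 1)‖ * r ^ (S.card + 1) = r * ∏ l ∈ S, max 1 (r / ‖l‖) := by
  classical
  induction S using Finset.induction_on with
  | empty => simp [expPoly]
  | insert l S hl ih =>
    obtain ⟨hl0, hlr⟩ := hS l (Finset.mem_insert_self _ _)
    have e : (expPoly S).coeff (S.card + 1 + 1) = 0 :=
      coeff_eq_zero_of_natDegree_lt (Nat.lt_succ_of_le (natDegree_expPoly_le S))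
    rw [expPoly_insert hl, Finset.card_insert_of_notMem hl, coeff_succ_mul_one_sub, e,
      Finset.prod_insert hl, zero_sub, norm_neg, norm_mul, norm_inv,
      max_eq_right ((one_le_div hl0).2 hlr)]
    have := ih fun l' h => hS l' (Finset.mem_insert_of_mem h)
    calc ‖l‖⁻¹ * ‖(expPoly S).coeff (S.card + 1)‖ * r ^ (S.card + 1 + 1)
        = r / ‖l‖ * (‖(expPoly S).coeff (S.card + 1)‖ * r ^ (S.card + 1)) := by ring
      _ = _ := by rw [this]; ring

section Ultrametric

variable {K : Type*} [NormedField K] [IsUltrametricDist K]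

theorem norm_sub_le_max_of_isUltrametricDist (x y : K) : ‖x - y‖ ≤ max ‖x‖ ‖y‖ := by
  simpa [sub_eq_add_neg] using IsUltrametricDist.norm_add_le_max x (-y)

theorem norm_sub_eq_left_of_lt {x y : K} (h : ‖y‖ < ‖x‖) : ‖x - y‖ = ‖x‖ := by
  have := IsUltrametricDist.norm_add_eq_max_of_norm_ne_norm (x := x) (y := -y)
    (by rw [norm_neg]; exact h.ne')
  rw [sub_eq_add_neg, this, norm_neg, max_eq_left h.le]

/-- The Gauss norm `max ‖aₘ‖ r ^ m` of `expPoly S` is at most `r ∏ max (1, r / ‖l‖)`. -/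
theorem norm_coeff_expPoly_le {r : ℝ} (hr : 0 < r) (S : Finset K) (m : ℕ) :
    ‖(expPoly S).coeff m‖ * r ^ m ≤ r * ∏ l ∈ S, max 1 (r / ‖l‖) := by
  classical
  induction S using Finset.induction_on generalizing m with
  | empty =>
    simp only [expPoly, Finset.prod_empty, mul_one, coeff_X]
    split_ifs with h
    · simp [← h]
    · simpa using hr.le
  | insert l S hl ih =>
    have hM : 0 ≤ r * ∏ l ∈ S, max 1 (r / ‖l‖) :=
      mul_nonneg hr.le (Finset.prod_nonneg fun _ _ => zero_le_one.trans (le_max_left _ _))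
    set M := r * ∏ l ∈ S, max 1 (r / ‖l‖)
    have e : r * ∏ l ∈ insert l S, max 1 (r / ‖l‖) = max 1 (r / ‖l‖) * M := by
      rw [Finset.prod_insert hl]
      ring
    have h1 : M ≤ max 1 (r / ‖l‖) * M := le_mul_of_one_le_left hM (le_max_left _ _)
    rw [e, expPoly_insert hl]
    cases m with
    | zero =>
      rw [coeff_zero_mul_one_sub]
      exact (ih 0).trans h1
    | succ m =>
      rw [coeff_succ_mul_one_sub]
      refine (mul_le_mul_of_nonneg_right (norm_sub_le_max_of_isUltrametricDist _ _)
        (by positivity)).trans ?_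
      rw [max_mul_of_nonneg _ _ (by positivity)]
      refine max_le ((ih _).trans h1) ?_
      calc ‖l⁻¹ * (expPoly S).coeff m‖ * r ^ (m + 1)
          = (r / ‖l‖) * (‖(expPoly S).coeff m‖ * r ^ m) := by
            rw [norm_mul, norm_inv]
            ring
        _ ≤ max 1 (r / ‖l‖) * M :=
            mul_le_mul (le_max_right _ _) (ih m) (by positivity)
              (zero_le_one.trans (le_max_left _ _))

/-- Elements of norm larger than `r` change neither the Gauss norm of `expPoly S` nor the norm of
a coefficient at which it is attained. -/
theorem norm_coeff_expPoly_of_subset {r : ℝ} (hr : 0 < r) {S S' : Finset K} (hSS' : S ⊆ S')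
    (hS' : ∀ l ∈ S', l ∉ S → r < ‖l‖) {n : ℕ}
    (hn : ‖(expPoly S).coeff n‖ * r ^ n = r * ∏ l ∈ S, max 1 (r / ‖l‖)) :
    ‖(expPoly S').coeff n‖ * r ^ n = r * ∏ l ∈ S, max 1 (r / ‖l‖) := by
  classical
  have key : ∀ T : Finset K, Disjoint S T → (∀ l ∈ T, r < ‖l‖) →
      ‖(expPoly (S ∪ T)).coeff n‖ * r ^ n = r * ∏ l ∈ S, max 1 (r / ‖l‖) ∧
      ∏ l ∈ S ∪ T, max 1 (r / ‖l‖) = ∏ l ∈ S, max 1 (r / ‖l‖) := by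
    intro T
    induction T using Finset.induction_on with
    | empty => intro _ _; simpa using hn
    | insert l T hl ih =>
      intro hd hT
      rw [Finset.disjoint_insert_right] at hd
      have hlr := hT l (Finset.mem_insert_self _ _)
      obtain ⟨ih1, ih2⟩ := ih hd.2 fun l' h => hT l' (Finset.mem_insert_of_mem h)
      have hlU : l ∉ S ∪ T := by simp [hd.1, hl]
      have hM : 0 < r * ∏ l ∈ S, max 1 (r / ‖l‖) :=
        mul_pos hr (Finset.prod_pos fun _ _ => zero_lt_one.trans_le (le_max_left _ _))
      have hlt : r / ‖l‖ < 1 := (div_lt_one (hr.trans hlr)).2 hlr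
      rw [Finset.union_insert, expPoly_insert hlU, Finset.prod_insert hlU, max_eq_left hlt.le,
        one_mul]
      refine ⟨?_, ih2⟩
      cases n with
      | zero => rwa [coeff_zero_mul_one_sub]
      | succ m =>
        rw [coeff_succ_mul_one_sub, norm_sub_eq_left_of_lt, ih1]
        refine lt_of_mul_lt_mul_right ?_ (pow_nonneg hr.le (m + 1))
        rw [ih1]
        calc ‖l⁻¹ * (expPoly (S ∪ T)).coeff m‖ * r ^ (m + 1)
            = (r / ‖l‖) * (‖(expPoly (S ∪ T)).coeff m‖ * r ^ m) := by
              rw [norm_mul, norm_inv]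
              ring
          _ ≤ (r / ‖l‖) * (r * ∏ l ∈ S, max 1 (r / ‖l‖)) := by
              rw [← ih2]
              exact mul_le_mul_of_nonneg_left (norm_coeff_expPoly_le hr _ m)
                (div_nonneg hr.le (norm_nonneg _))
          _ < r * ∏ l ∈ S, max 1 (r / ‖l‖) := mul_lt_of_lt_one_left hM hlt
  have h := (key (S' \ S) Finset.disjoint_sdiff fun l hl =>
    hS' l (Finset.mem_sdiff.1 hl).1 (Finset.mem_sdiff.1 hl).2).1
  rwa [Finset.union_sdiff_of_subset hSS'] at h

/-- If all zeros of a polynomial have norm larger than `ρ`, then its constant term dominates on the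
disc of radius `ρ`. -/
theorem norm_coeff_prod_X_sub_C_lt {ρ : ℝ} (hρ : 0 < ρ) (s : Multiset K)
    (hs : ∀ y ∈ s, ρ < ‖y‖) :
    0 < ‖((s.map fun y => X - C y).prod).coeff 0‖ ∧ ∀ m, 0 < m →
      ‖((s.map fun y => X - C y).prod).coeff m‖ * ρ ^ m <
        ‖((s.map fun y => X - C y).prod).coeff 0‖ := by
  induction s using Multiset.induction_on with
  | empty =>
    refine ⟨by simp, fun m hm => ?_⟩
    simp [coeff_one, hm.ne']
  | cons y s ih =>
    obtain ⟨ih0, ih⟩ := ih fun z hz => hs z (Multiset.mem_cons_of_mem hz)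
    have hy := hs y (Multiset.mem_cons_self _ _)
    have hy0 := hρ.trans hy
    rw [Multiset.map_cons, Multiset.prod_cons]
    set f := (s.map fun y => X - C y).prod
    have e0 : ‖((X - C y) * f).coeff 0‖ = ‖y‖ * ‖f.coeff 0‖ := by
      simp [sub_mul]
    rw [e0]
    refine ⟨mul_pos hy0 ih0, fun m hm => ?_⟩
    obtain ⟨m, rfl⟩ := Nat.exists_eq_succ_of_ne_zero hm.ne'
    have e : ((X - C y) * f).coeff (m + 1) = f.coeff m - y * f.coeff (m + 1) := by
      simp [sub_mul]
    rw [Nat.succ_eq_add_one, e]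
    refine (mul_le_mul_of_nonneg_right (norm_sub_le_max_of_isUltrametricDist _ _)
      (by positivity)).trans_lt ?_
    rw [max_mul_of_nonneg _ _ (by positivity), norm_mul]
    refine max_lt ?_ ?_
    · have : ‖f.coeff m‖ * ρ ^ m ≤ ‖f.coeff 0‖ := by
        rcases Nat.eq_zero_or_pos m with rfl | h
        · simp
        · exact (ih m h).le
      calc ‖f.coeff m‖ * ρ ^ (m + 1) = ρ * (‖f.coeff m‖ * ρ ^ m) := by ring
        _ ≤ ρ * ‖f.coeff 0‖ := mul_le_mul_of_nonneg_left this hρ.le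
        _ < ‖y‖ * ‖f.coeff 0‖ := mul_lt_mul_of_pos_right hy ih0
    · rw [mul_assoc]
      exact mul_lt_mul_of_pos_left (ih _ m.succ_pos) hy0

/-- The part of the theory of Newton polygons used here: a polynomial whose constant term does not
dominate on the disc of radius `ρ` has a zero in it. -/
theorem exists_root_norm_le [IsAlgClosed K] {ρ : ℝ} (hρ : 0 < ρ) (p : K[X]) {n : ℕ} (hn : 0 < n)
    (h : ‖p.coeff 0‖ ≤ ‖p.coeff n‖ * ρ ^ n) : ∃ y, ‖y‖ ≤ ρ ∧ p.eval y = 0 := by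
  by_cases hp : p = 0
  · exact ⟨0, by simpa using hρ.le, by simp [hp]⟩
  by_contra! hcon
  have hroots : ∀ y ∈ p.roots, ρ < ‖y‖ := fun y hy => by
    by_contra! hle
    exact hcon y hle (isRoot_of_mem_roots hy)
  obtain ⟨h0, hlt⟩ := norm_coeff_prod_X_sub_C_lt hρ p.roots hroots
  have hfac := (IsAlgClosed.splits p).eq_prod_roots
  have hlc : 0 < ‖p.leadingCoeff‖ := norm_pos_iff.2 (leadingCoeff_ne_zero.2 hp)
  rw [hfac, coeff_C_mul, coeff_C_mul, norm_mul, norm_mul, mul_assoc] at h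
  exact absurd (le_of_mul_le_mul_left h hlc) (not_le.2 (hlt n hn))

end Ultrametric

/-! ### Linearized polynomials -/

section Linearized

variable (F : Type*) [Field F] [Finite F]

theorem add_pow_natCard {R : Type*} [CommRing R] [Algebra F R] (x y : R) :
    (x + y) ^ Nat.card F = x ^ Nat.card F + y ^ Nat.card F := by
  have := Fintype.ofFinite F
  rw [Nat.card_eq_fintype_card]
  exact map_add (FiniteField.frobeniusAlgHom F R) x y

theorem add_pow_natCard_pow {R : Type*} [CommRing R] [Algebra F R] (x y : R) (i : ℕ) :
    (x + y) ^ Nat.card F ^ i = x ^ Nat.card F ^ i + y ^ Nat.card F ^ i := by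
  induction i with
  | zero => simp
  | succ i ih => rw [pow_succ, pow_mul, ih, add_pow_natCard F, ← pow_mul, ← pow_mul]

theorem algebraMap_pow_natCard_pow {R : Type*} [CommRing R] [Algebra F R] (c : F) (i : ℕ) :
    algebraMap F R c ^ Nat.card F ^ i = algebraMap F R c := by
  have := Fintype.ofFinite F
  rw [Nat.card_eq_fintype_card, ← map_pow, FiniteField.pow_card_pow]

variable {K : Type*} [Field K] [Algebra F K]

/-- Polynomials in which only the monomials `X ^ (q ^ i)` occur, where `q = #F`. -/
def IsLinearized (p : K[X]) : Prop :=
  ∀ m, p.coeff m ≠ 0 → ∃ i, m = Nat.card F ^ i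

variable {F}

theorem IsLinearized.eval_add {p : K[X]} (hp : IsLinearized F p) (x y : K) :
    p.eval (x + y) = p.eval x + p.eval y := by
  simp only [eval_eq_sum, Polynomial.sum]
  rw [← Finset.sum_add_distrib]
  refine Finset.sum_congr rfl fun m hm => ?_
  obtain ⟨i, rfl⟩ := hp m (mem_support_iff.1 hm)
  rw [add_pow_natCard_pow F, mul_add]

theorem IsLinearized.eval_smul {p : K[X]} (hp : IsLinearized F p) (c : F) (x : K) :
    p.eval (c • x) = c • p.eval x := by
  simp only [eval_eq_sum, Polynomial.sum]
  rw [Finset.smul_sum]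
  refine Finset.sum_congr rfl fun m hm => ?_
  obtain ⟨i, rfl⟩ := hp m (mem_support_iff.1 hm)
  rw [Algebra.smul_def, mul_pow, algebraMap_pow_natCard_pow, Algebra.smul_def]
  ring

theorem pow_natCard_eq_expand (p : K[X]) :
    ∃ p' : K[X], p ^ Nat.card F = expand K (Nat.card F) p' ∧
      ∀ m, p'.coeff m = p.coeff m ^ Nat.card F := by
  have := Fintype.ofFinite F
  have hq : Nat.card F = Fintype.card F := Nat.card_eq_fintype_card
  refine ⟨p.map (FiniteField.frobeniusAlgHom F K).toRingHom, ?_, fun m => ?_⟩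
  · induction p using Polynomial.induction_on' with
    | add p p' hp hp' => rw [add_pow_natCard F, hp, hp', Polynomial.map_add, map_add]
    | monomial n a =>
      rw [monomial_pow, map_monomial, expand_monomial, hq, mul_comm]
      rfl
  · rw [coeff_map, hq]
    rfl

theorem coeff_pow_natCard_mul (p : K[X]) (m : ℕ) :
    (p ^ Nat.card F).coeff (m * Nat.card F) = p.coeff m ^ Nat.card F := by
  obtain ⟨p', h, h'⟩ := pow_natCard_eq_expand (F := F) p
  rw [h, coeff_expand_mul Nat.card_pos, h']

theorem IsLinearized.pow_natCard {p : K[X]} (hp : IsLinearized F p) :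
    IsLinearized F (p ^ Nat.card F) := by
  intro m hm
  obtain ⟨p', h, h'⟩ := pow_natCard_eq_expand (F := F) p
  rw [h, coeff_expand Nat.card_pos] at hm
  split_ifs at hm with hd
  · obtain ⟨n, rfl⟩ := hd
    rw [Nat.mul_div_cancel_left _ Nat.card_pos, h'] at hm
    obtain ⟨i, rfl⟩ := hp n fun h0 => hm (by rw [h0, zero_pow Nat.card_pos.ne'])
    exact ⟨i + 1, by rw [pow_succ, mul_comm]⟩
  · exact absurd rfl hm

omit [Field F] [Finite F] [Algebra F K] in
theorem IsLinearized.sub_C_mul {p p' : K[X]} (hp : IsLinearized F p) (hp' : IsLinearized F p')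
    (a : K) : IsLinearized F (p - C a * p') := by
  intro m hm
  rw [coeff_sub, coeff_C_mul] at hm
  by_cases h : p.coeff m = 0
  · refine hp' m fun h' => hm ?_
    rw [h, h', mul_zero, sub_zero]
  · exact hp m h

omit [Finite F] in
theorem card_add_one_eq_natCard {W : Submodule F K} {S : Finset K}
    (hS : ∀ x, x ∈ S ↔ x ∈ W ∧ x ≠ 0) : S.card + 1 = Nat.card W := by
  classical
  have h0 : (0 : K) ∉ S := fun h => ((hS 0).1 h).2 rfl
  have e : (W : Set K) = (insert 0 S : Finset K) := by
    ext x
    by_cases hx : x = 0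
    · simp [hx]
    · simp [hx, hS]
  have : Nat.card W = (W : Set K).ncard := rfl
  rw [this, e, Set.ncard_coe_finset, Finset.card_insert_of_notMem h0]

theorem natCard_sup_span_singleton {W : Submodule F K} [Finite W] {x : K} (hx : x ∉ W) :
    Nat.card F * Nat.card W ≤ Nat.card (W ⊔ Submodule.span F {x} : Submodule F K) := by
  have : Finite (W ⊔ Submodule.span F {x} : Submodule F K) := by
    have : Module.Finite F W := Module.Finite.of_finite
    have : Finite (Submodule.span F {x}) := Module.finite_of_finite F
    exact Module.finite_of_finite F
  rw [← Nat.card_prod]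
  let f : F × W → (W ⊔ Submodule.span F {x} : Submodule F K) := fun t =>
    ⟨t.2 + t.1 • x, Submodule.add_mem_sup t.2.2
      (Submodule.smul_mem _ _ (Submodule.mem_span_singleton_self x))⟩
  refine Nat.card_le_card_of_injective f ?_
  rintro ⟨c, w⟩ ⟨c', w'⟩ h
  have h : (w : K) + c • x = w' + c' • x := congrArg Subtype.val h
  have h1 : (c' - c) • x = w - w' := by
    rw [sub_smul]
    linear_combination -h
  have hc : c' - c = 0 := by
    by_contra hc
    exact hx ((Submodule.smul_mem_iff W hc).1 (h1 ▸ W.sub_mem w.2 w'.2))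
  rw [hc, zero_smul] at h1
  rw [sub_eq_zero.1 hc, Subtype.ext (sub_eq_zero.1 h1.symm)]

/-- The effect on the exponential function of adjoining an element `x` to a finite `F`-space `W`:
`e_{W + Fx} = e_W - e_W ^ q / e_W(x) ^ (q - 1)`, as both sides have the same zeros. -/
theorem expPoly_sup_span_singleton {W : Submodule F K} {x : K} (hx : x ∉ W) {S S' : Finset K}
    (hS : ∀ y, y ∈ S ↔ y ∈ W ∧ y ≠ 0)
    (hS' : ∀ y, y ∈ S' ↔ y ∈ W ⊔ Submodule.span F {x} ∧ y ≠ 0)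
    (hlin : IsLinearized F (expPoly S)) :
    expPoly S' = expPoly S -
      C (((expPoly S).eval x ^ (Nat.card F - 1))⁻¹) * expPoly S ^ Nat.card F := by
  classical
  have hq : 1 < Nat.card F := Finite.one_lt_card
  have hq' : Nat.card F - 1 + 1 = Nat.card F := by omega
  have h0S : (0 : K) ∉ S := fun h => ((hS 0).1 h).2 rfl
  have h0S' : (0 : K) ∉ S' := fun h => ((hS' 0).1 h).2 rfl
  have : Finite W := by
    refine Set.Finite.subset (insert 0 S : Finset K).finite_toSet fun y hy => ?_
    by_cases h : y = 0
    · simp [h]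
    · simp [hS, h, show y ∈ W from hy]
  have hzero : ∀ y ∈ W, (expPoly S).eval y = 0 := fun y hy => by
    rw [eval_expPoly_eq_zero_iff S h0S, hS]
    tauto
  have hex : (expPoly S).eval x ≠ 0 := by
    rw [Ne, eval_expPoly_eq_zero_iff S h0S, hS]
    rintro (rfl | h)
    · exact hx W.zero_mem
    · exact hx h.1
  symm
  have hcoeff : ∀ m, m < Nat.card F → (expPoly S ^ Nat.card F).coeff m = 0 := by
    refine X_pow_dvd_iff.1 ?_
    rw [expPoly, mul_pow]
    exact dvd_mul_right _ _
  refine eq_expPoly h0S' ?_ ?_ ?_ fun y hy => ?_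
  · refine (natDegree_sub_le _ _).trans (max_le ?_ ?_)
    · refine (natDegree_expPoly_le S).trans (Nat.succ_le_succ (Finset.card_le_card fun y hy => ?_))
      exact (hS' y).2 ⟨Submodule.mem_sup_left ((hS y).1 hy).1, ((hS y).1 hy).2⟩
    · refine (natDegree_C_mul_le _ _).trans (natDegree_pow_le.trans ?_)
      rw [card_add_one_eq_natCard hS']
      refine le_trans ?_ (natCard_sup_span_singleton hx)
      rw [← card_add_one_eq_natCard hS]
      exact Nat.mul_le_mul_left _ (natDegree_expPoly_le S)
  · rw [coeff_sub, coeff_C_mul, hcoeff 0 (by omega), coeff_zero_expPoly, mul_zero, sub_zero]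
  · rw [coeff_sub, coeff_C_mul, hcoeff 1 hq, coeff_one_expPoly, mul_zero, sub_zero]
  · obtain ⟨w, hw, z, hz, rfl⟩ := Submodule.mem_sup.1 ((hS' y).1 hy).1
    obtain ⟨c, rfl⟩ := Submodule.mem_span_singleton.1 hz
    have hcq : algebraMap F K c ^ Nat.card F = algebraMap F K c := by
      simpa using algebraMap_pow_natCard_pow F (R := K) c 1
    rw [eval_sub, eval_C_mul, eval_pow, hlin.eval_add, hzero w hw, zero_add, hlin.eval_smul,
      Algebra.smul_def, mul_pow, hcq]
    have e : (expPoly S).eval x ^ Nat.card F =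
        (expPoly S).eval x ^ (Nat.card F - 1) * (expPoly S).eval x := by
      rw [← pow_succ, hq']
    rw [e]
    field_simp
    ring

/-- The exponential function of a finite `F`-space is linearized. -/
theorem isLinearized_expPoly {W : Submodule F K} {S : Finset K}
    (hS : ∀ y, y ∈ S ↔ y ∈ W ∧ y ≠ 0) : IsLinearized F (expPoly S) := by
  classical
  have key : ∀ T : Finset K, ∀ S : Finset K,
      (∀ y, y ∈ S ↔ y ∈ Submodule.span F (T : Set K) ∧ y ≠ 0) → IsLinearized F (expPoly S) := by
    intro T
    induction T using Finset.induction_on with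
    | empty =>
      intro S hS
      have : S = ∅ := Finset.eq_empty_of_forall_notMem fun y hy => by
        have := (hS y).1 hy
        simp at this
      rw [this]
      intro m hm
      refine ⟨0, ?_⟩
      by_contra h
      refine hm ?_
      have h1 : ¬ 1 = m := by simpa using fun h' => h (by rw [← h', pow_zero])
      simp [expPoly, coeff_X, h1]
    | insert x T _ ih =>
      intro S hS
      have e : Submodule.span F ((insert x T : Finset K) : Set K) =
          Submodule.span F (T : Set K) ⊔ Submodule.span F {x} := by
        rw [Finset.coe_insert, Submodule.span_insert, sup_comm]
      rw [e] at hS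
      by_cases hx : x ∈ Submodule.span F (T : Set K)
      · refine ih S fun y => ?_
        rw [hS, sup_eq_left.2 ((Submodule.span_singleton_le_iff_mem _ _).2 hx)]
      · have hT : ∀ y, y ∈ S.filter (· ∈ Submodule.span F (T : Set K)) ↔
            y ∈ Submodule.span F (T : Set K) ∧ y ≠ 0 := fun y => by
          rw [Finset.mem_filter, hS]
          exact ⟨fun h => ⟨h.2, h.1.2⟩, fun h => ⟨⟨Submodule.mem_sup_left h.1, h.2⟩, h.1⟩⟩
        rw [expPoly_sup_span_singleton hx hT hS (ih _ hT)]
        exact (ih _ hT).sub_C_mul (ih _ hT).pow_natCard _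
  refine key S S fun y => ?_
  rw [hS]
  refine and_congr_left fun hy => ⟨fun h => ?_, fun h => ?_⟩
  · exact Submodule.subset_span ((hS y).2 ⟨h, hy⟩)
  · exact Submodule.span_le.2 (fun z hz => ((hS z).1 hz).1) h

theorem IsLinearized.eval_eq_tsum {K : Type*} [Field K] [TopologicalSpace K]
    {p : K[X]} (hp : IsLinearized F p) (x : K) :
    p.eval x = ∑' i, p.coeff (Nat.card F ^ i) * x ^ Nat.card F ^ i := by
  have hinj : Function.Injective fun i : ℕ => Nat.card F ^ i :=
    Nat.pow_right_injective Finite.one_lt_card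
  have hsupp : (Function.support fun m => p.coeff m * x ^ m) ⊆
      Set.range fun i : ℕ => Nat.card F ^ i := by
    intro m hm
    obtain ⟨i, hi⟩ := hp m (left_ne_zero_of_mul hm)
    exact ⟨i, hi.symm⟩
  rw [hinj.tsum_eq hsupp (f := fun m => p.coeff m * x ^ m), eval_eq_sum, Polynomial.sum,
    tsum_eq_sum]
  intro m hm
  rw [notMem_support_iff.1 hm, zero_mul]

end Linearized

/-! ### Entire linearized series -/

namespace CInfty

variable {F : Type*} [Field F] [Finite F]

theorem norm_smul_of_ne_zero {c : F} (hc : c ≠ 0) (x : CInfty F) : ‖c • x‖ = ‖x‖ := by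
  rw [Algebra.smul_def, norm_mul]
  change ‖ofConst F c‖ * _ = _
  rw [norm_ofConst F hc, one_mul]

theorem norm_smul_le (c : F) (x : CInfty F) : ‖c • x‖ ≤ ‖x‖ := by
  by_cases hc : c = 0
  · simp [hc]
  · exact (norm_smul_of_ne_zero hc x).le

theorem exists_norm_sub_ofAlg_le (x : CInfty F) {ε : ℝ} (hε : 0 < ε) :
    ∃ y, ‖x - ofAlg F y‖ ≤ ε := by
  obtain ⟨y, hy⟩ := (denseRange_ofAlg F).exists_dist_lt x hε
  exact ⟨y, by rw [← dist_eq_norm]; exact hy.le⟩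

/-- There are infinitely many units whose `(q - 1)`-th powers have distinct residues, since nonzero
elements that are algebraic over the constants have absolute value `1`. -/
theorem exists_units_norm_sub_eq_one (F : Type*) [Field F] [Finite F] :
    ∃ ζ : ℕ → CInfty F, (∀ i, ‖ζ i‖ = 1) ∧
      ∀ i j, i ≠ j → ‖ζ i ^ (Nat.card F - 1) - ζ j ^ (Nat.card F - 1)‖ = 1 := by
  let φ₀ : F →+* KInftyAlg F := (algebraMap (KInfty F) (KInftyAlg F)).comp
    ((KInfty.ofRatFunc F).comp RatFunc.C)
  let : Algebra F (KInftyAlg F) := φ₀.toAlgebra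
  let φ : AlgebraicClosure F →+* CInfty F :=
    (ofAlg F).comp (IsAlgClosed.lift (M := KInftyAlg F) (R := F)
      (S := AlgebraicClosure F)).toRingHom
  have hφ : ∀ a, a ≠ 0 → ‖φ a‖ = 1 := by
    intro a ha
    have hint : IsIntegral F a := Algebra.IsIntegral.isIntegral a
    have : FiniteDimensional F (IntermediateField.adjoin F {a}) :=
      IntermediateField.adjoin.finiteDimensional hint
    have : Finite (IntermediateField.adjoin F {a}) := Module.finite_of_finite F
    let b : (IntermediateField.adjoin F {a})ˣ :=
      Units.mk0 ⟨a, IntermediateField.mem_adjoin_simple_self F a⟩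
        (fun h => ha (congrArg Subtype.val h))
    obtain ⟨n, hn, hb⟩ := (isOfFinOrder_of_finite b).exists_pow_eq_one
    have han : a ^ n = 1 := by
      have h := congrArg (fun u : (IntermediateField.adjoin F {a})ˣ =>
        ((u : IntermediateField.adjoin F {a}) : AlgebraicClosure F)) hb
      simpa [b] using h
    refine (pow_eq_one_iff_of_nonneg (norm_nonneg _) hn.ne').1 ?_
    rw [← norm_pow, ← map_pow, han, map_one, norm_one]
  have hq : 0 < Nat.card F - 1 := Nat.sub_pos_of_lt Finite.one_lt_card
  have : Infinite {a : AlgebraicClosure F // a ≠ 0} :=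
    (Set.finite_singleton (0 : AlgebraicClosure F)).infinite_compl.to_subtype
  let e := Infinite.natEmbedding {a : AlgebraicClosure F // a ≠ 0}
  choose z hz using fun i => IsAlgClosed.exists_pow_nat_eq (e i : AlgebraicClosure F) hq
  refine ⟨fun i => φ (z i), fun i => hφ _ fun h => (e i).2 ?_, fun i j hij => ?_⟩
  · rw [← hz, h, zero_pow hq.ne']
  · rw [← map_pow, ← map_pow, ← map_sub, hz, hz]
    exact hφ _ (sub_ne_zero.2 fun h => hij (e.injective (Subtype.ext h)))

/-- The value at `x` of the linearized series `∑ gᵢ X ^ (q ^ i)`. -/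
noncomputable def linSeries (g : ℕ → CInfty F) (x : CInfty F) : CInfty F :=
  ∑' i, g i * x ^ Nat.card F ^ i

/-- The linearized series `∑ gᵢ X ^ (q ^ i)` converges on all of `C_∞`. -/
def IsEntire (g : ℕ → CInfty F) : Prop :=
  ∀ R : ℝ, 0 < R → Tendsto (fun i => ‖g i‖ * R ^ Nat.card F ^ i) atTop (𝓝 0)

theorem IsEntire.tendsto {g : ℕ → CInfty F} (hg : IsEntire g) (x : CInfty F) :
    Tendsto (fun i => g i * x ^ Nat.card F ^ i) atTop (𝓝 0) := by
  refine squeeze_zero_norm (fun i => ?_) (hg (‖x‖ + 1) (by positivity))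
  rw [norm_mul, norm_pow]
  gcongr
  linarith

theorem IsEntire.summable {g : ℕ → CInfty F} (hg : IsEntire g) (x : CInfty F) :
    Summable fun i => g i * x ^ Nat.card F ^ i :=
  NonarchimedeanAddGroup.summable_of_tendsto_cofinite_zero
    (Nat.cofinite_eq_atTop ▸ hg.tendsto x)

theorem IsEntire.linSeries_add {g : ℕ → CInfty F} (hg : IsEntire g) (x y : CInfty F) :
    linSeries g (x + y) = linSeries g x + linSeries g y := by
  rw [linSeries, linSeries, linSeries, ← (hg.summable x).tsum_add (hg.summable y)]
  refine tsum_congr fun i => ?_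
  rw [add_pow_natCard_pow F, mul_add]

theorem norm_linSeries_le {g : ℕ → CInfty F} {x : CInfty F} {M : ℝ} (hM : 0 ≤ M)
    (h : ∀ i, ‖g i‖ * ‖x‖ ^ Nat.card F ^ i ≤ M) : ‖linSeries g x‖ ≤ M :=
  IsUltrametricDist.norm_tsum_le_of_forall_le_of_nonneg hM fun i => by
    rw [norm_mul, norm_pow]
    exact h i

theorem IsEntire.continuous_linSeries {g : ℕ → CInfty F} (hg : IsEntire g) :
    Continuous (linSeries g) := by
  let f : CInfty F →+ CInfty F := AddMonoidHom.mk' (linSeries g) hg.linSeries_add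
  obtain ⟨B, hB⟩ := (hg 1 one_pos).bddAbove_range
  have hB' : ∀ i, ‖g i‖ ≤ B := fun i => by
    simpa using hB (Set.mem_range_self i)
  have hB0 : 0 ≤ B := (norm_nonneg _).trans (hB' 0)
  refine continuous_of_continuousAt_zero f ?_
  rw [ContinuousAt, map_zero]
  have h : ∀ᶠ x : CInfty F in 𝓝 0, ‖f x‖ ≤ B * ‖x‖ := by
    filter_upwards [Metric.closedBall_mem_nhds (0 : CInfty F) one_pos] with x hx
    have hx : ‖x‖ ≤ 1 := by simpa using hx
    refine norm_linSeries_le (by positivity) fun i => ?_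
    gcongr
    · exact hB' i
    · exact pow_le_of_le_one (norm_nonneg _) hx (pow_ne_zero _ Nat.card_pos.ne')
  refine squeeze_zero_norm' h ?_
  have : Tendsto (fun x : CInfty F => B * ‖x‖) (𝓝 0) (𝓝 (B * ‖(0 : CInfty F)‖)) :=
    (continuous_const.mul continuous_norm).tendsto 0
  simpa using this

/-- Approximate solutions of `g(y) = u`: the series is truncated and its coefficients are
approximated in the algebraic closure of `K_∞`, where the resulting polynomial equation is
solvable. -/
theorem IsEntire.exists_norm_linSeries_sub_le {g : ℕ → CInfty F} (hg : IsEntire g) {ρ : ℝ}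
    (hρ : 0 < ρ) {u : CInfty F} {j : ℕ} (hu : ‖u‖ ≤ ‖g j‖ * ρ ^ Nat.card F ^ j) {ε : ℝ}
    (hε : 0 < ε) : ∃ y, ‖y‖ ≤ ρ ∧ ‖linSeries g y - u‖ ≤ ε := by
  rcases eq_or_ne u 0 with rfl | hu0
  · refine ⟨0, by simpa using hρ.le, ?_⟩
    have : linSeries g 0 = 0 := by
      simp [linSeries, Nat.card_pos.ne']
    simpa [this] using hε.le
  have hgj : 0 < ‖g j‖ * ρ ^ Nat.card F ^ j := (norm_pos_iff.2 hu0).trans_le hu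
  -- the approximation has to be fine enough to preserve the absolute value of `g j`
  set δ := min ε (‖g j‖ * ρ ^ Nat.card F ^ j / 2)
  have hδ : 0 < δ := lt_min hε (half_pos hgj)
  have hδε : δ ≤ ε := min_le_left _ _
  have hδj : δ < ‖g j‖ * ρ ^ Nat.card F ^ j :=
    (min_le_right _ _).trans_lt (half_lt_self hgj)
  obtain ⟨N, hN⟩ := eventually_atTop.1 ((hg ρ hρ).eventually_le_const hε)
  obtain ⟨u', hu'⟩ := exists_norm_sub_ofAlg_le u hδ
  choose g' hg' using fun i => exists_norm_sub_ofAlg_le (g i)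
    (show 0 < δ / ρ ^ Nat.card F ^ i by positivity)
  have hg' : ∀ i, ‖g i - ofAlg F (g' i)‖ * ρ ^ Nat.card F ^ i ≤ δ := fun i =>
    (le_div_iff₀ (by positivity)).1 (hg' i)
  set N' := max N (j + 1)
  let p : (KInftyAlg F)[X] := ∑ i ∈ Finset.range N', C (g' i) * X ^ Nat.card F ^ i - C u'
  have hqpos : ∀ i, 0 < Nat.card F ^ i := fun i => pow_pos Nat.card_pos i
  have hp0 : p.coeff 0 = -u' := by
    simp only [p, coeff_sub, finsetSum_coeff, coeff_C_mul, coeff_X_pow, (hqpos _).ne]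
    simp
  have hinj : Function.Injective fun i : ℕ => Nat.card F ^ i :=
    Nat.pow_right_injective Finite.one_lt_card
  have hpj : p.coeff (Nat.card F ^ j) = g' j := by
    simp only [p, coeff_sub, finsetSum_coeff, coeff_C_mul, coeff_X_pow,
      coeff_C_of_ne_zero (hqpos j).ne', sub_zero]
    rw [Finset.sum_eq_single j]
    · simp
    · intro i _ hij
      rw [if_neg fun h => hij (hinj h.symm), mul_zero]
    · intro h
      exact absurd (Finset.mem_range.2 (lt_of_lt_of_le j.lt_succ_self (le_max_right _ _))) h
  have hgj' : ‖g' j‖ = ‖g j‖ := by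
    have h1 : ‖g j - ofAlg F (g' j)‖ < ‖g j‖ :=
      lt_of_mul_lt_mul_right ((hg' j).trans_lt hδj) (by positivity)
    have h2 := norm_sub_eq_left_of_lt h1
    rwa [sub_sub_cancel, norm_ofAlg] at h2
  obtain ⟨y, hy, hroot⟩ := exists_root_norm_le hρ p (hqpos j) (by
    rw [hp0, hpj, hgj', norm_neg, ← norm_ofAlg]
    have : ofAlg F u' = u - (u - ofAlg F u') := by ring
    rw [this]
    exact (norm_sub_le_max_of_isUltrametricDist _ _).trans (max_le hu (hu'.trans hδj.le)))
  have hyρ : ‖ofAlg F y‖ ≤ ρ := by rwa [norm_ofAlg]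
  refine ⟨ofAlg F y, hyρ, ?_⟩
  have hroot' : ∑ i ∈ Finset.range N', ofAlg F (g' i) * ofAlg F y ^ Nat.card F ^ i =
      ofAlg F u' := by
    have : ∑ i ∈ Finset.range N', g' i * y ^ Nat.card F ^ i = u' := by
      simpa [p, eval_finsetSum, sub_eq_zero] using hroot
    rw [← this, map_sum]
    simp
  have e : linSeries g (ofAlg F y) - u =
      ∑ i ∈ Finset.range N', (g i - ofAlg F (g' i)) * ofAlg F y ^ Nat.card F ^ i +
        (∑' i, g (i + N') * ofAlg F y ^ Nat.card F ^ (i + N') - (u - ofAlg F u')) := by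
    rw [linSeries, ← (hg.summable (ofAlg F y)).sum_add_tsum_nat_add N', ← hroot']
    simp only [sub_mul, Finset.sum_sub_distrib]
    ring
  rw [e]
  refine (IsUltrametricDist.norm_add_le_max _ _).trans (max_le ?_
    ((norm_sub_le_max_of_isUltrametricDist _ _).trans (max_le ?_ (hu'.trans hδε))))
  · refine IsUltrametricDist.norm_sum_le_of_forall_le_of_nonneg hε.le fun i _ => ?_
    rw [norm_mul, norm_pow]
    refine le_trans ?_ ((hg' i).trans hδε)
    gcongr
  · refine IsUltrametricDist.norm_tsum_le_of_forall_le_of_nonneg hε.le fun i => ?_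
    rw [norm_mul, norm_pow]
    refine le_trans ?_ (hN (i + N') ((le_max_left _ _).trans (Nat.le_add_left _ _)))
    gcongr

/-- The equation `g(y) = u` for an entire linearized series `g` with linear coefficient `1` has a
solution in every disc on which some term of `g` has absolute values as large as `‖u‖`. Since `g`
is additive, approximate solutions can be corrected successively, and the corrections shrink like
the errors. -/
theorem IsEntire.exists_linSeries_eq {g : ℕ → CInfty F} (hg : IsEntire g) (hg0 : g 0 = 1) {ρ : ℝ}
    (hρ : 0 < ρ) {u : CInfty F} {j : ℕ} (hu : ‖u‖ ≤ ‖g j‖ * ρ ^ Nat.card F ^ j) :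
    ∃ y, ‖y‖ ≤ ρ ∧ linSeries g y = u := by
  have step : ∀ (n : ℕ) (v : CInfty F), ∃ y, ‖v‖ ≤ ρ / 2 ^ n →
      ‖y‖ ≤ ρ / 2 ^ n ∧ ‖v - linSeries g y‖ ≤ ρ / 2 ^ (n + 1) := by
    intro n v
    by_cases hv : ‖v‖ ≤ ρ / 2 ^ n
    · obtain ⟨y, hy, hy'⟩ := hg.exists_norm_linSeries_sub_le (ρ := ρ / 2 ^ n) (by positivity)
        (u := v) (j := 0) (by simpa [hg0] using hv) (ε := ρ / 2 ^ (n + 1)) (by positivity)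
      exact ⟨y, fun _ => ⟨hy, by rwa [norm_sub_rev]⟩⟩
    · exact ⟨0, fun h => absurd h hv⟩
  choose f hf using step
  obtain ⟨y₀, hy₀, hy₀'⟩ := hg.exists_norm_linSeries_sub_le hρ hu hρ
  let v : ℕ → CInfty F :=
    fun n => Nat.rec (u - linSeries g y₀) (fun n w => w - linSeries g (f n w)) n
  have hv : ∀ n, ‖v n‖ ≤ ρ / 2 ^ n := by
    intro n
    induction n with
    | zero =>
      rw [norm_sub_rev] at hy₀'
      simpa [v] using hy₀'
    | succ n ih => exact (hf n (v n) ih).2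
  let y : ℕ → CInfty F := fun n => f n (v n)
  have hy : ∀ n, ‖y n‖ ≤ ρ / 2 ^ n := fun n => (hf n (v n) (hv n)).1
  have hlim : Tendsto (fun n : ℕ => ρ / 2 ^ n) atTop (𝓝 0) := by
    simpa [div_eq_mul_inv] using
      (tendsto_pow_atTop_nhds_zero_of_lt_one (r := (2⁻¹ : ℝ)) (by norm_num)
        (by norm_num)).const_mul ρ
  have hsum : Summable y := NonarchimedeanAddGroup.summable_of_tendsto_cofinite_zero
    (Nat.cofinite_eq_atTop ▸ squeeze_zero_norm hy hlim)
  refine ⟨y₀ + ∑' n, y n, ?_, ?_⟩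
  · refine (IsUltrametricDist.norm_add_le_max _ _).trans (max_le hy₀ ?_)
    refine IsUltrametricDist.norm_tsum_le_of_forall_le_of_nonneg hρ.le fun n => (hy n).trans ?_
    exact div_le_self hρ.le (one_le_pow₀ one_le_two)
  · have hpart : ∀ n, linSeries g (y₀ + ∑ i ∈ Finset.range n, y i) = u - v n := by
      intro n
      induction n with
      | zero => simp [v]
      | succ n ih =>
        rw [Finset.sum_range_succ, ← add_assoc, hg.linSeries_add, ih]
        change _ = u - (v n - linSeries g (y n))
        ring
    have h1 : Tendsto (fun n => linSeries g (y₀ + ∑ i ∈ Finset.range n, y i)) atTop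
        (𝓝 (linSeries g (y₀ + ∑' n, y n))) :=
      (hg.continuous_linSeries.tendsto _).comp (hsum.hasSum.tendsto_sum_nat.const_add y₀)
    have h2 : Tendsto (fun n => u - v n) atTop (𝓝 (u - 0)) :=
      (squeeze_zero_norm hv hlim).const_sub u
    rw [sub_zero] at h2
    exact tendsto_nhds_unique h1 (h2.congr fun n => (hpart n).symm)

/-- Every nonzero element of `C_∞` has a `(q - 1)`-th root. -/
theorem exists_pow_eq {η : CInfty F} (hη : η ≠ 0) : ∃ w, w ^ (Nat.card F - 1) = η := by
  have hq : 1 < Nat.card F := Finite.one_lt_card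
  have hq' : Nat.card F - 1 + 1 = Nat.card F := by omega
  have hη' : 0 < ‖η‖ := norm_pos_iff.2 hη
  obtain ⟨a, ha⟩ := exists_norm_sub_ofAlg_le η (half_pos hη')
  have ha : ‖η - ofAlg F a‖ < ‖η‖ := ha.trans_lt (half_lt_self hη')
  obtain ⟨b, hb⟩ := IsAlgClosed.exists_pow_nat_eq a (Nat.sub_pos_of_lt hq)
  set w₀ := ofAlg F b
  have hw₀ : w₀ ^ (Nat.card F - 1) = ofAlg F a := by rw [← map_pow, hb]
  have hw₀n : 0 < ‖w₀‖ := by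
    refine norm_pos_iff.2 fun h => ?_
    rw [h, zero_pow (Nat.sub_pos_of_lt hq).ne'] at hw₀
    rw [← hw₀, sub_zero] at ha
    exact lt_irrefl _ ha
  -- `w` is a zero of the linearized polynomial `X - η⁻¹ X ^ q` near the approximate zero `w₀`
  let g : ℕ → CInfty F := fun i => if i = 0 then 1 else if i = 1 then -η⁻¹ else 0
  have hg2 : ∀ i, i ∉ Finset.range 2 → g i = 0 := fun i hi => by
    have : 2 ≤ i := not_lt.1 fun h => hi (Finset.mem_range.2 h)
    simp [g, show i ≠ 0 by omega, show i ≠ 1 by omega]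
  have hg : IsEntire g := fun R _ => by
    refine tendsto_const_nhds.congr' ?_
    filter_upwards [eventually_ge_atTop 2] with i hi
    rw [hg2 i fun h => absurd (Finset.mem_range.1 h) (not_lt.2 hi), norm_zero, zero_mul]
  have hgx : ∀ x, linSeries g x = x - η⁻¹ * x ^ Nat.card F := fun x => by
    rw [linSeries, tsum_eq_sum (s := Finset.range 2) fun i hi => by rw [hg2 i hi, zero_mul]]
    simp [Finset.sum_range_succ, g, sub_eq_add_neg]
  have hval : linSeries g w₀ = η⁻¹ * (η - ofAlg F a) * w₀ := by
    rw [hgx, ← hq', pow_succ, hw₀]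
    field_simp
  have hlt : ‖linSeries g w₀‖ < ‖w₀‖ := by
    rw [hval, norm_mul, norm_mul, norm_inv]
    refine mul_lt_of_lt_one_left hw₀n ?_
    rwa [inv_mul_lt_one₀ hη']
  have hw : ∃ w, linSeries g w = 0 ∧ w ≠ 0 := by
    rcases eq_or_ne (linSeries g w₀) 0 with h0 | h0
    · exact ⟨w₀, h0, norm_pos_iff.1 hw₀n⟩
    obtain ⟨y, hy, hyu⟩ := hg.exists_linSeries_eq (by simp [g]) (norm_pos_iff.2 h0)
      (u := -linSeries g w₀) (j := 0) (by simp [g])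
    refine ⟨w₀ + y, by rw [hg.linSeries_add, hyu, add_neg_cancel], fun h => ?_⟩
    rw [eq_neg_of_add_eq_zero_right h, norm_neg] at hy
    exact absurd hlt (not_lt.2 hy)
  obtain ⟨w, hw, hw0⟩ := hw
  refine ⟨w, ?_⟩
  rw [hgx, ← hq', pow_succ] at hw
  field_simp at hw
  rw [mul_zero] at hw
  exact (sub_eq_zero.1 ((mul_eq_zero.1 hw).resolve_left hw0)).symm

end CInfty

/-! ### The coefficients of the exponential function -/

namespace FLattice

variable {F : Type*} [Field F] [Finite F]

/-- The nonzero elements of `V` of absolute value at most `R`. -/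
noncomputable def ball (V : FLattice F) (R : ℝ) : Finset (CInfty F) :=
  open scoped Classical in (V.finite_ball R).toFinset.erase 0

theorem mem_ball {V : FLattice F} {R : ℝ} {x : CInfty F} :
    x ∈ V.ball R ↔ x ≠ 0 ∧ x ∈ V.toSubmodule ∧ ‖x‖ ≤ R := by
  simp [ball]

theorem ball_mono (V : FLattice F) {R R' : ℝ} (h : R ≤ R') : V.ball R ⊆ V.ball R' := fun x hx => by
  rw [mem_ball] at hx ⊢
  exact ⟨hx.1, hx.2.1, hx.2.2.trans h⟩

/-- The elements of `V` of absolute value at most `R`; they form a subspace since the absolute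
value is ultrametric. -/
def ballSubmodule (V : FLattice F) (R : ℝ) (hR : 0 ≤ R) : Submodule F (CInfty F) where
  carrier := {x | x ∈ V.toSubmodule ∧ ‖x‖ ≤ R}
  add_mem' hx hy := ⟨V.toSubmodule.add_mem hx.1 hy.1,
    (IsUltrametricDist.norm_add_le_max _ _).trans (max_le hx.2 hy.2)⟩
  zero_mem' := ⟨V.toSubmodule.zero_mem, by simpa using hR⟩
  smul_mem' c _ hx := ⟨V.toSubmodule.smul_mem c hx.1, (CInfty.norm_smul_le c _).trans hx.2⟩

theorem mem_ball_iff {V : FLattice F} {R : ℝ} (hR : 0 ≤ R) (x : CInfty F) :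
    x ∈ V.ball R ↔ x ∈ V.ballSubmodule R hR ∧ x ≠ 0 :=
  mem_ball.trans and_comm

theorem isLinearized_expPoly_ball (V : FLattice F) {R : ℝ} (hR : 0 ≤ R) :
    IsLinearized F (expPoly (V.ball R)) :=
  isLinearized_expPoly (mem_ball_iff hR)

open scoped PowerSeries.WithPiTopology in
theorem tendsto_coeff_expPoly_ball (V : FLattice F) (m : ℕ) :
    Tendsto (fun n : ℕ => (expPoly (V.ball n)).coeff m) atTop
      (𝓝 (PowerSeries.coeff m V.exp)) := by
  classical
  let s : ℕ → Finset {l : CInfty F // l ∈ V.toSubmodule ∧ l ≠ 0} :=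
    fun n => (V.ball n).subtype _
  have hs : Tendsto s atTop atTop := by
    refine tendsto_atTop_finset_of_monotone (fun n n' h => ?_) fun l => ?_
    · exact Finset.subtype_mono (V.ball_mono (by exact_mod_cast h))
    · obtain ⟨n, hn⟩ := exists_nat_ge ‖(l : CInfty F)‖
      exact ⟨n, Finset.mem_subtype.2 (mem_ball.2 ⟨l.2.2, l.2.1, hn⟩)⟩
  have hprod := V.multipliable_exp.hasProd
  rw [HasProd, SummationFilter.unconditional_filter] at hprod
  have hprod := (PowerSeries.WithPiTopology.tendsto_iff_coeff_tendsto _ _ _ _).1 (hprod.comp hs)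
  have e : ∀ n : ℕ, ∏ l ∈ s n, (1 - PowerSeries.C (l : CInfty F)⁻¹ * PowerSeries.X) =
      ((∏ l ∈ V.ball n, (1 - C l⁻¹ * X) : (CInfty F)[X]) : PowerSeries (CInfty F)) := by
    intro n
    have h1 : ∏ l ∈ s n, (1 - PowerSeries.C (l : CInfty F)⁻¹ * PowerSeries.X) =
        ∏ l ∈ V.ball n, (1 - PowerSeries.C l⁻¹ * PowerSeries.X) :=
      Finset.prod_subtype_of_mem (fun l => 1 - PowerSeries.C l⁻¹ * PowerSeries.X)
        fun l hl => ⟨(mem_ball.1 hl).2.1, (mem_ball.1 hl).1⟩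
    rw [h1, ← Polynomial.coeToPowerSeries.ringHom_apply, map_prod]
    simp
  cases m with
  | zero =>
    simp only [coeff_zero_expPoly, exp]
    simp
  | succ m =>
    rw [exp, PowerSeries.coeff_succ_X_mul]
    refine (hprod m).congr fun n => ?_
    rw [Function.comp_apply, e, Polynomial.coeff_coe, expPoly, coeff_X_mul]

theorem tendsto_alpha (V : FLattice F) (i : ℕ) :
    Tendsto (fun n : ℕ => (expPoly (V.ball n)).coeff (Nat.card F ^ i)) atTop (𝓝 (V.alpha i)) :=
  V.tendsto_coeff_expPoly_ball _

theorem alpha_zero (V : FLattice F) : V.alpha 0 = 1 := by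
  refine tendsto_nhds_unique (V.tendsto_alpha 0) ?_
  simp only [pow_zero, coeff_one_expPoly]
  exact tendsto_const_nhds

/-- The Gauss norm of `e_V` on the disc of radius `r`, that is `max ‖αᵢ(V)‖ r ^ (q ^ i)`, expressed
by the elements of `V` in this disc. -/
noncomputable def gaussNorm (V : FLattice F) (r : ℝ) : ℝ :=
  r * ∏ l ∈ V.ball r, max 1 (r / ‖l‖)

theorem gaussNorm_pos (V : FLattice F) {r : ℝ} (hr : 0 < r) : 0 < V.gaussNorm r :=
  mul_pos hr (Finset.prod_pos fun _ _ => zero_lt_one.trans_le (le_max_left _ _))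

theorem gaussNorm_eq_of_le (V : FLattice F) {r R : ℝ} (hr : 0 < r) (h : r ≤ R) :
    r * ∏ l ∈ V.ball R, max 1 (r / ‖l‖) = V.gaussNorm r := by
  rw [gaussNorm, Finset.prod_subset (V.ball_mono h)]
  intro l hl hl'
  rw [mem_ball] at hl hl'
  have : r < ‖l‖ := by
    by_contra! h'
    exact hl' ⟨hl.1, hl.2.1, h'⟩
  exact max_eq_left ((div_lt_one (hr.trans this)).2 this).le

theorem norm_coeff_expPoly_ball_le (V : FLattice F) {r R : ℝ} (hr : 0 < r) (h : r ≤ R) (m : ℕ) :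
    ‖(expPoly (V.ball R)).coeff m‖ * r ^ m ≤ V.gaussNorm r := by
  rw [← V.gaussNorm_eq_of_le hr h]
  exact norm_coeff_expPoly_le hr _ m

theorem norm_alpha_le (V : FLattice F) {r : ℝ} (hr : 0 < r) (i : ℕ) :
    ‖V.alpha i‖ * r ^ Nat.card F ^ i ≤ V.gaussNorm r := by
  refine le_of_tendsto ((V.tendsto_alpha i).norm.mul_const _) ?_
  filter_upwards [eventually_ge_atTop ⌈r⌉₊] with n hn
  exact V.norm_coeff_expPoly_ball_le hr (Nat.ceil_le.1 hn) _

/-- If `V` has exactly `q ^ j` elements in the disc of radius `r`, then the term of index `j` of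
`e_V` attains the Gauss norm: up to sign, `αⱼ` is an elementary symmetric function of the inverses
of the nonzero elements of `V`, and one of its terms dominates all others. -/
theorem norm_alpha_eq (V : FLattice F) {r : ℝ} (hr : 0 < r) {j : ℕ}
    (hj : (V.ball r).card + 1 = Nat.card F ^ j) :
    ‖V.alpha j‖ * r ^ Nat.card F ^ j = V.gaussNorm r := by
  refine tendsto_nhds_unique ((V.tendsto_alpha j).norm.mul_const _)
    (tendsto_const_nhds.congr' ?_)
  filter_upwards [eventually_ge_atTop ⌈r⌉₊] with n hn
  refine (norm_coeff_expPoly_of_subset hr (V.ball_mono (Nat.ceil_le.1 hn)) (fun l hl hl' => ?_)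
    ?_).symm
  · rw [mem_ball] at hl hl'
    by_contra! h'
    exact hl' ⟨hl.1, hl.2.1, h'⟩
  · rw [← hj]
    exact norm_leadingCoeff_expPoly fun l hl =>
      ⟨norm_pos_iff.2 (mem_ball.1 hl).1, (mem_ball.1 hl).2.2⟩

theorem isEntire_alpha (V : FLattice F) : CInfty.IsEntire V.alpha := by
  intro R hR
  have hM := V.gaussNorm_pos (r := 2 * R) (by positivity)
  refine squeeze_zero (fun i => by positivity) (g := fun i => V.gaussNorm (2 * R) * 2⁻¹ ^ i)
    (fun i => ?_) ?_
  · calc ‖V.alpha i‖ * R ^ Nat.card F ^ i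
        = (‖V.alpha i‖ * (2 * R) ^ Nat.card F ^ i) * 2⁻¹ ^ Nat.card F ^ i := by
          rw [mul_assoc, ← mul_pow]
          congr 2
          ring
      _ ≤ V.gaussNorm (2 * R) * 2⁻¹ ^ Nat.card F ^ i := by
          gcongr
          exact V.norm_alpha_le (by positivity) i
      _ ≤ V.gaussNorm (2 * R) * 2⁻¹ ^ i := by
          gcongr ?_ * ?_
          exact pow_le_pow_of_le_one (by norm_num) (by norm_num)
            (Nat.lt_pow_self Finite.one_lt_card).le
  · simpa using (tendsto_pow_atTop_nhds_zero_of_lt_one (r := (2⁻¹ : ℝ)) (by norm_num)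
      (by norm_num)).const_mul (V.gaussNorm (2 * R))

theorem tendsto_eval_expPoly_ball (V : FLattice F) (x : CInfty F) :
    Tendsto (fun n : ℕ => (expPoly (V.ball n)).eval x) atTop
      (𝓝 (CInfty.linSeries V.alpha x)) := by
  set R := 2 * (‖x‖ + 1)
  have hR : 0 < R := by positivity
  have hM := V.gaussNorm_pos hR
  have hx : ‖x‖ ≤ R * 2⁻¹ := by
    simp only [R]
    linarith
  have h := tendsto_tsum_of_dominated_convergence (𝓕 := atTop)
    (f := fun (n : ℕ) i => (expPoly (V.ball n)).coeff (Nat.card F ^ i) * x ^ Nat.card F ^ i)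
    (g := fun i => V.alpha i * x ^ Nat.card F ^ i)
    (bound := fun i => V.gaussNorm R * 2⁻¹ ^ i)
    ((summable_geometric_of_lt_one (by norm_num) (by norm_num)).mul_left _)
    (fun i => (V.tendsto_alpha i).mul_const _) (by
      filter_upwards [eventually_ge_atTop ⌈R⌉₊] with n hn i
      rw [norm_mul, norm_pow]
      calc ‖(expPoly (V.ball n)).coeff (Nat.card F ^ i)‖ * ‖x‖ ^ Nat.card F ^ i
          ≤ ‖(expPoly (V.ball n)).coeff (Nat.card F ^ i)‖ * (R * 2⁻¹) ^ Nat.card F ^ i := by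
            gcongr
        _ = (‖(expPoly (V.ball n)).coeff (Nat.card F ^ i)‖ * R ^ Nat.card F ^ i) *
              2⁻¹ ^ Nat.card F ^ i := by
            rw [mul_pow, mul_assoc]
        _ ≤ V.gaussNorm R * 2⁻¹ ^ Nat.card F ^ i := by
            gcongr
            exact V.norm_coeff_expPoly_ball_le hR (Nat.ceil_le.1 hn) _
        _ ≤ V.gaussNorm R * 2⁻¹ ^ i := by
            gcongr ?_ * ?_
            exact pow_le_pow_of_le_one (by norm_num) (by norm_num)
              (Nat.lt_pow_self Finite.one_lt_card).le)
  refine h.congr fun n => ?_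
  exact ((V.isLinearized_expPoly_ball n.cast_nonneg).eval_eq_tsum x).symm

theorem linSeries_alpha_eq_zero (V : FLattice F) {v : CInfty F} (hv : v ∈ V.toSubmodule) :
    CInfty.linSeries V.alpha v = 0 := by
  refine tendsto_nhds_unique (V.tendsto_eval_expPoly_ball v) (tendsto_const_nhds.congr' ?_)
  filter_upwards [eventually_ge_atTop ⌈‖v‖⌉₊] with n hn
  rw [eq_comm, eval_expPoly_eq_zero_iff _ fun h => (mem_ball.1 h).1 rfl, mem_ball]
  by_cases h : v = 0
  · exact Or.inl h
  · exact Or.inr ⟨h, hv, Nat.ceil_le.1 hn⟩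

/-! ### Adjoining an element to a lattice -/

theorem max_norm_le_norm_add_smul {W : Submodule F (CInfty F)} {x : CInfty F}
    (hx : ∀ v ∈ W, ‖x‖ ≤ ‖v + x‖) {v : CInfty F} (hv : v ∈ W) {c : F}
    (hc : c ≠ 0) : max ‖v‖ ‖x‖ ≤ ‖v + c • x‖ := by
  have h1 : ‖x‖ ≤ ‖v + c • x‖ := by
    have := hx _ (W.smul_mem c⁻¹ hv)
    rwa [← CInfty.norm_smul_of_ne_zero hc (c⁻¹ • v + x), smul_add, smul_inv_smul₀ hc] at this
  refine max_le ?_ h1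
  rcases le_or_gt ‖v‖ ‖x‖ with h | h
  · exact h.trans h1
  · have h2 : ‖v‖ ≠ ‖c • x‖ := by
      rw [CInfty.norm_smul_of_ne_zero hc]
      exact h.ne'
    rw [IsUltrametricDist.norm_add_eq_max_of_norm_ne_norm h2]
    exact le_max_left _ _

/-- The lattice `V + F x`, for an element `x` whose distance to `V` is `‖x‖`. -/
noncomputable def adjoin (V : FLattice F) (x : CInfty F)
    (hx : ∀ v ∈ V.toSubmodule, ‖x‖ ≤ ‖v + x‖) : FLattice F where
  toSubmodule := V.toSubmodule ⊔ Submodule.span F {x}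
  finite_ball R := by
    refine (((V.finite_ball R).prod (Set.finite_univ (α := F))).image
      fun t => t.1 + t.2 • x).subset ?_
    rintro y ⟨hy, hyR⟩
    obtain ⟨v, hv, z, hz, rfl⟩ := Submodule.mem_sup.1 hy
    obtain ⟨c, rfl⟩ := Submodule.mem_span_singleton.1 hz
    refine ⟨(v, c), ⟨⟨hv, ?_⟩, trivial⟩, rfl⟩
    by_cases hc : c = 0
    · simpa [hc] using hyR
    · exact (le_max_left _ _).trans ((max_norm_le_norm_add_smul hx hv hc).trans hyR)

section Adjoin

variable {V : FLattice F} {x : CInfty F} (hx : ∀ v ∈ V.toSubmodule, ‖x‖ ≤ ‖v + x‖)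
include hx

theorem notMem_of_norm_le (hx0 : x ≠ 0) : x ∉ V.toSubmodule := fun h => by
  have := hx _ (V.toSubmodule.neg_mem h)
  rw [neg_add_cancel, norm_zero] at this
  exact hx0 (norm_le_zero_iff.1 this)

theorem mem_ball_adjoin {R : ℝ} (hR : 0 ≤ R) (hxR : ‖x‖ ≤ R) (y : CInfty F) :
    y ∈ (V.adjoin x hx).ball R ↔
      y ∈ V.ballSubmodule R hR ⊔ Submodule.span F {x} ∧ y ≠ 0 := by
  rw [mem_ball, and_comm]
  refine and_congr_left fun _ => ⟨?_, fun hy => ?_⟩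
  · rintro ⟨hy, hyR⟩
    obtain ⟨v, hv, z, hz, rfl⟩ := Submodule.mem_sup.1 hy
    refine Submodule.add_mem_sup ⟨hv, ?_⟩ hz
    obtain ⟨c, rfl⟩ := Submodule.mem_span_singleton.1 hz
    by_cases hc : c = 0
    · simpa [hc] using hyR
    · exact (le_max_left _ _).trans ((max_norm_le_norm_add_smul hx hv hc).trans hyR)
  · obtain ⟨v, hv, z, hz, rfl⟩ := Submodule.mem_sup.1 hy
    refine ⟨Submodule.add_mem_sup hv.1 hz, ?_⟩
    obtain ⟨c, rfl⟩ := Submodule.mem_span_singleton.1 hz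
    exact (IsUltrametricDist.norm_add_le_max _ _).trans
      (max_le hv.2 ((CInfty.norm_smul_le c x).trans hxR))

theorem gaussNorm_adjoin (hx0 : x ≠ 0) : (V.adjoin x hx).gaussNorm ‖x‖ = V.gaussNorm ‖x‖ := by
  rw [gaussNorm, gaussNorm]
  congr 1
  symm
  refine Finset.prod_subset (fun y hy => ?_) fun y hy hy' => ?_
  · rw [mem_ball] at hy ⊢
    exact ⟨hy.1, Submodule.mem_sup_left hy.2.1, hy.2.2⟩
  · rw [mem_ball] at hy hy'
    obtain ⟨v, hv, z, hz, rfl⟩ := Submodule.mem_sup.1 hy.2.1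
    obtain ⟨c, rfl⟩ := Submodule.mem_span_singleton.1 hz
    have hc : c ≠ 0 := by
      rintro rfl
      rw [zero_smul, add_zero] at hy hy'
      exact hy' ⟨hy.1, hv, hy.2.2⟩
    have h := (le_max_right _ _).trans (max_norm_le_norm_add_smul hx hv hc)
    exact max_eq_left ((div_le_one ((norm_pos_iff.2 hx0).trans_le h)).2 h)

theorem alpha_adjoin (hx0 : x ≠ 0) (he : CInfty.linSeries V.alpha x ≠ 0) (i : ℕ) :
    (V.adjoin x hx).alpha (i + 1) = V.alpha (i + 1) -
      (CInfty.linSeries V.alpha x ^ (Nat.card F - 1))⁻¹ * V.alpha i ^ Nat.card F := by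
  refine tendsto_nhds_unique ((V.adjoin x hx).tendsto_alpha (i + 1)) ?_
  refine ((V.tendsto_alpha (i + 1)).sub
    ((((V.tendsto_eval_expPoly_ball x).pow (Nat.card F - 1)).inv₀ (pow_ne_zero _ he)).mul
      ((V.tendsto_alpha i).pow (Nat.card F)))).congr' ?_
  filter_upwards [eventually_ge_atTop ⌈‖x‖⌉₊] with n hn
  have hn0 : (0 : ℝ) ≤ n := n.cast_nonneg
  rw [expPoly_sup_span_singleton (W := V.ballSubmodule n hn0)
    (fun h => notMem_of_norm_le hx hx0 h.1) (mem_ball_iff hn0)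
    (mem_ball_adjoin hx hn0 (Nat.ceil_le.1 hn)) (V.isLinearized_expPoly_ball hn0), coeff_sub,
    coeff_C_mul, pow_succ, coeff_pow_natCard_mul]

end Adjoin

/-- If `‖e_V(x)‖` is as large as possible for `‖x‖ ≤ r`, then `x` has distance `r` from `V`. -/
theorem le_norm_add_of_norm_linSeries_eq (V : FLattice F) {r : ℝ} (hr : 0 < r) {x : CInfty F}
    (hx : ‖CInfty.linSeries V.alpha x‖ = V.gaussNorm r) {v : CInfty F} (hv : v ∈ V.toSubmodule) :
    r ≤ ‖v + x‖ := by
  by_contra! hlt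
  have hM := V.gaussNorm_pos hr
  have h1 : ‖CInfty.linSeries V.alpha (v + x)‖ ≤ V.gaussNorm r * (‖v + x‖ / r) := by
    refine CInfty.norm_linSeries_le (by positivity) fun i => ?_
    calc ‖V.alpha i‖ * ‖v + x‖ ^ Nat.card F ^ i
        = (‖V.alpha i‖ * r ^ Nat.card F ^ i) * (‖v + x‖ / r) ^ Nat.card F ^ i := by
          rw [div_pow]
          field_simp
      _ ≤ V.gaussNorm r * (‖v + x‖ / r) := by
          gcongr
          · exact V.norm_alpha_le hr i
          · exact pow_le_of_le_one (by positivity) ((div_le_one hr).2 hlt.le)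
              (pow_ne_zero _ Nat.card_pos.ne')
  rw [V.isEntire_alpha.linSeries_add, V.linSeries_alpha_eq_zero hv, zero_add, hx] at h1
  exact absurd h1 (not_le.2 (mul_lt_of_lt_one_right hM ((div_lt_one hr).2 hlt)))

/-- An element `x` of absolute value and distance `r` from `V` can be chosen with a prescribed value
`w = e_V(x)`, provided that `‖w‖` is the Gauss norm of `e_V` at `r` and that the latter is attained
by some term. -/
theorem exists_adjoin (V : FLattice F) {r : ℝ} (hr : 0 < r) {j : ℕ}
    (hj : ‖V.alpha j‖ * r ^ Nat.card F ^ j = V.gaussNorm r) {w : CInfty F}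
    (hw : ‖w‖ = V.gaussNorm r) :
    ∃ (x : CInfty F) (V' : FLattice F), ‖x‖ = r ∧ (∀ v ∈ V.toSubmodule, r ≤ ‖v + x‖) ∧
      V'.toSubmodule = V.toSubmodule ⊔ Submodule.span F {x} ∧ V'.gaussNorm r = V.gaussNorm r ∧
      ∀ i, V'.alpha (i + 1) =
        V.alpha (i + 1) - (w ^ (Nat.card F - 1))⁻¹ * V.alpha i ^ Nat.card F := by
  obtain ⟨x, hxr, hxw⟩ := V.isEntire_alpha.exists_linSeries_eq V.alpha_zero hr
    (u := w) (j := j) (by rw [hw, hj])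
  have hdist : ∀ v ∈ V.toSubmodule, r ≤ ‖v + x‖ := fun v hv =>
    V.le_norm_add_of_norm_linSeries_eq hr (by rw [hxw, hw]) hv
  have hx : ‖x‖ = r := le_antisymm hxr (by simpa using hdist 0 V.toSubmodule.zero_mem)
  have hx0 : x ≠ 0 := norm_pos_iff.1 (hx ▸ hr)
  have hw0 : w ≠ 0 := norm_pos_iff.1 (hw ▸ V.gaussNorm_pos hr)
  have hdist' : ∀ v ∈ V.toSubmodule, ‖x‖ ≤ ‖v + x‖ := by rwa [hx]
  refine ⟨x, V.adjoin x hdist', hx, hdist, rfl, ?_, fun i => ?_⟩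
  · rw [← hx]
    exact gaussNorm_adjoin hdist' hx0
  · rw [alpha_adjoin hdist' hx0 (hxw ▸ hw0), hxw]

end FLattice

namespace FLattice

variable {F : Type*} [Field F] [Finite F]

/-- If the linear polynomial `a - b X` has Gauss norm `m` and `θ`, `θ'` have distinct residues, then
`a - b X` has absolute value `m` at one of them. -/
theorem norm_sub_mul_eq_or {a b θ θ' : CInfty F} {m : ℝ} (ha : ‖a‖ ≤ m) (hb : ‖b‖ ≤ m)
    (hab : ‖a‖ = m ∨ ‖b‖ = m) (hθ : ‖θ‖ = 1) (hθ' : ‖θ'‖ = 1) (hθθ' : ‖θ - θ'‖ = 1) :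
    ‖a - b * θ‖ = m ∨ ‖a - b * θ'‖ = m := by
  have hle : ∀ t : CInfty F, ‖t‖ = 1 → ‖a - b * t‖ ≤ m := fun t ht => by
    refine (norm_sub_le_max_of_isUltrametricDist _ _).trans (max_le ha ?_)
    rwa [norm_mul, ht, mul_one]
  by_contra! h
  have h1 := lt_of_le_of_ne (hle θ hθ) h.1
  have h2 := lt_of_le_of_ne (hle θ' hθ') h.2
  have hb' : ‖b‖ < m := by
    have e : b * (θ - θ') = (a - b * θ') - (a - b * θ) := by ring
    rw [← mul_one ‖b‖, ← hθθ', ← norm_mul, e]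
    exact (norm_sub_le_max_of_isUltrametricDist _ _).trans_lt (max_lt h2 h1)
  have ha' : ‖a‖ = m := hab.resolve_right hb'.ne
  refine h.1 ?_
  rw [norm_sub_eq_left_of_lt, ha']
  rwa [norm_mul, hθ, mul_one, ha']

theorem norm_inv_pow_mul_alpha_pow (V : FLattice F) {r : ℝ} {w : CInfty F}
    (hw : ‖w‖ = V.gaussNorm r) (i : ℕ) :
    ‖(w ^ (Nat.card F - 1))⁻¹ * V.alpha i ^ Nat.card F‖ * r ^ Nat.card F ^ (i + 1) =
      (‖V.alpha i‖ * r ^ Nat.card F ^ i) ^ Nat.card F / V.gaussNorm r ^ (Nat.card F - 1) := by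
  rw [norm_mul, norm_inv, norm_pow, norm_pow, hw, mul_pow, ← pow_mul, ← pow_succ]
  ring

theorem pow_natCard_div_pow {F : Type*} [Finite F] [Nontrivial F] {M : ℝ} (hM : 0 < M) :
    M ^ Nat.card F / M ^ (Nat.card F - 1) = M := by
  have hq' : Nat.card F - 1 + 1 = Nat.card F := Nat.sub_add_cancel Nat.card_pos
  conv_lhs => rw [← hq', Nat.add_sub_cancel, pow_succ]
  field_simp

theorem exists_and_of_forall_ne_or {P Q : ℕ → Prop} (hP : ∀ m n, m ≠ n → P m ∨ P n)
    (hQ : ∀ m n, m ≠ n → Q m ∨ Q n) : ∃ n, P n ∧ Q n := by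
  by_contra! h
  have h01 := hP 0 1 (by omega)
  have h02 := hP 0 2 (by omega)
  have h12 := hP 1 2 (by omega)
  have g01 := hQ 0 1 (by omega)
  have g02 := hQ 0 2 (by omega)
  have g12 := hQ 1 2 (by omega)
  have c0 := h 0
  have c1 := h 1
  have c2 := h 2
  tauto

/-- Adjoining a generic element of absolute value and distance `r` preserves that the Gauss norm
is attained at the term of index `l`, and makes the next term attain it as well. The recursion for
the coefficients excludes at most one residue class of `e_V(x) ^ (q - 1)` for each of the two
terms. -/
theorem exists_generic_adjoin (V : FLattice F) {r : ℝ} (hr : 0 < r) {y : CInfty F} (hy : ‖y‖ = r)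
    {l : ℕ} (hl : ‖V.alpha l‖ * r ^ Nat.card F ^ l = V.gaussNorm r) :
    ∃ (x : CInfty F) (V' : FLattice F), ‖x‖ = r ∧ (∀ v ∈ V.toSubmodule, r ≤ ‖v + x‖) ∧
      V'.toSubmodule = V.toSubmodule ⊔ Submodule.span F {x} ∧
      ‖V'.alpha l‖ * r ^ Nat.card F ^ l = V'.gaussNorm r ∧
      ‖V'.alpha (l + 1)‖ * r ^ Nat.card F ^ (l + 1) = V'.gaussNorm r := by
  have hM := V.gaussNorm_pos hr
  obtain ⟨ζ, hζ, hζζ⟩ := CInfty.exists_units_norm_sub_eq_one F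
  set w₀ := V.alpha l * y ^ Nat.card F ^ l
  have hw₀ : ‖w₀‖ = V.gaussNorm r := by rw [← hl, norm_mul, norm_pow, hy]
  set b : ℕ → CInfty F := fun i => (w₀ ^ (Nat.card F - 1))⁻¹ * V.alpha i ^ Nat.card F
  -- the new coefficients, when `x` is chosen with `e_V(x) = w₀ / ζ n`
  set a : ℕ → ℕ → CInfty F := fun n i => V.alpha (i + 1) - b i * ζ n ^ (Nat.card F - 1)
  have hb : ∀ i, ‖b i‖ * r ^ Nat.card F ^ (i + 1) ≤ V.gaussNorm r := fun i => by
    rw [V.norm_inv_pow_mul_alpha_pow hw₀]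
    refine le_trans ?_ (pow_natCard_div_pow (F := F) hM).le
    gcongr
    exact V.norm_alpha_le hr i
  have hbl : ‖b l‖ * r ^ Nat.card F ^ (l + 1) = V.gaussNorm r := by
    rw [V.norm_inv_pow_mul_alpha_pow hw₀, hl, pow_natCard_div_pow hM]
  have key : ∀ i, ‖V.alpha (i + 1)‖ * r ^ Nat.card F ^ (i + 1) = V.gaussNorm r ∨
      ‖b i‖ * r ^ Nat.card F ^ (i + 1) = V.gaussNorm r → ∀ n n', n ≠ n' →
      ‖a n i‖ * r ^ Nat.card F ^ (i + 1) = V.gaussNorm r ∨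
      ‖a n' i‖ * r ^ Nat.card F ^ (i + 1) = V.gaussNorm r := by
    intro i h n n' hn
    have hpos : 0 < r ^ Nat.card F ^ (i + 1) := by positivity
    simp only [← eq_div_iff hpos.ne'] at h ⊢
    refine norm_sub_mul_eq_or ((le_div_iff₀ hpos).2 (V.norm_alpha_le hr _))
      ((le_div_iff₀ hpos).2 (hb i)) h ?_ ?_ (hζζ n n' hn)
    · rw [norm_pow, hζ, one_pow]
    · rw [norm_pow, hζ, one_pow]
  have hex : ∃ n, (∀ i, l = i + 1 → ‖a n i‖ * r ^ Nat.card F ^ (i + 1) = V.gaussNorm r) ∧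
      ‖a n l‖ * r ^ Nat.card F ^ (l + 1) = V.gaussNorm r := by
    have k2 := key l (Or.inr hbl)
    cases l with
    | zero =>
      rcases k2 0 1 (by omega) with h | h
      · exact ⟨0, fun i hi => by omega, h⟩
      · exact ⟨1, fun i hi => by omega, h⟩
    | succ l =>
      have k1 := key l (Or.inl hl)
      obtain ⟨n, hn, hn'⟩ := exists_and_of_forall_ne_or k1 k2
      refine ⟨n, fun i hi => ?_, hn'⟩
      obtain rfl : l = i := by omega
      exact hn
  obtain ⟨n, hn, hn'⟩ := hex
  obtain ⟨x, V', hx, hdist, hV', hg, hα⟩ := V.exists_adjoin hr hl (w := w₀ * (ζ n)⁻¹)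
    (by rw [norm_mul, norm_inv, hζ, hw₀, inv_one, mul_one])
  have hα' : ∀ i, V'.alpha (i + 1) = a n i := fun i => by
    rw [hα, mul_pow, mul_inv, inv_pow, inv_inv]
    simp only [a, b]
    ring
  refine ⟨x, V', hx, hdist, hV', ?_, by rw [hα', hn', hg]⟩
  cases l with
  | zero => rw [hg, ← hl, V.alpha_zero, V'.alpha_zero]
  | succ l => rw [hα', hn l rfl, hg]

/-- If the Gauss norm is attained at the terms of indices `l` and `l + 1`, then the latter can be
removed by adjoining an element of absolute value and distance `r`. -/
theorem exists_adjoin_alpha_eq_zero (V : FLattice F) {r : ℝ} (hr : 0 < r) {l : ℕ}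
    (hl : ‖V.alpha l‖ * r ^ Nat.card F ^ l = V.gaussNorm r)
    (hl' : ‖V.alpha (l + 1)‖ * r ^ Nat.card F ^ (l + 1) = V.gaussNorm r) :
    ∃ (x : CInfty F) (V' : FLattice F), ‖x‖ = r ∧ (∀ v ∈ V.toSubmodule, r ≤ ‖v + x‖) ∧
      V'.toSubmodule = V.toSubmodule ⊔ Submodule.span F {x} ∧ V'.alpha (l + 1) = 0 := by
  have hM := V.gaussNorm_pos hr
  have hq : 0 < Nat.card F - 1 := Nat.sub_pos_of_lt Finite.one_lt_card
  have hq' : Nat.card F - 1 + 1 = Nat.card F := by omega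
  have h0 : V.alpha l ≠ 0 := fun h => by
    rw [h, norm_zero, zero_mul] at hl
    exact hM.ne hl
  have h0' : V.alpha (l + 1) ≠ 0 := fun h => by
    rw [h, norm_zero, zero_mul] at hl'
    exact hM.ne hl'
  obtain ⟨w, hw⟩ := CInfty.exists_pow_eq
    (div_ne_zero (pow_ne_zero (Nat.card F) h0) h0')
  have hwn : ‖w‖ = V.gaussNorm r := by
    refine (pow_left_inj₀ (norm_nonneg _) hM.le hq.ne').1 ?_
    have hpos : 0 < r ^ Nat.card F ^ (l + 1) := by positivity
    have e : ‖V.alpha l‖ ^ Nat.card F * r ^ Nat.card F ^ (l + 1) =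
        V.gaussNorm r ^ Nat.card F := by
      rw [← hl, mul_pow, ← pow_mul, ← pow_succ]
    rw [← norm_pow, hw, norm_div, norm_pow, div_eq_iff (norm_ne_zero_iff.2 h0')]
    refine mul_right_cancel₀ hpos.ne' ?_
    rw [e, mul_assoc, hl', ← pow_succ, hq']
  obtain ⟨x, V', hx, hdist, hV', -, hα⟩ := V.exists_adjoin hr hl hwn
  refine ⟨x, V', hx, hdist, hV', ?_⟩
  rw [hα, hw, inv_div, div_mul_cancel₀ _ (pow_ne_zero _ h0), sub_self]

/-! ### Orthogonal families and spectra -/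

section Orthogonal

variable {ι : Type*}

/-- The family `μ` is orthogonal on the set `I` of indices: no linear combination of the `μ i` with
`i ∈ I` is smaller than one of its terms. -/
def IsOrthogonalOn (μ : ι → CInfty F) (I : Set ι) : Prop :=
  ∀ c : ι →₀ F, (c.support : Set ι) ⊆ I → ∀ i, c i ≠ 0 →
    ‖μ i‖ ≤ ‖Finsupp.linearCombination F μ c‖

theorem IsOrthogonalOn.mono {μ : ι → CInfty F} {I I' : Set ι} (h : IsOrthogonalOn μ I)
    (hI : I' ⊆ I) : IsOrthogonalOn μ I' :=
  fun c hc => h c (hc.trans hI)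

theorem IsOrthogonalOn.linearIndepOn {μ : ι → CInfty F} {I : Set ι} (h : IsOrthogonalOn μ I)
    (h0 : ∀ i, μ i ≠ 0) : LinearIndepOn F μ I := by
  rw [linearIndepOn_iff]
  intro c hc hc0
  by_contra hne
  obtain ⟨i, hi⟩ := Finsupp.ne_iff.1 hne
  have := h c ((Finsupp.mem_supported _ _).1 hc) i hi
  rw [hc0, norm_zero] at this
  exact h0 i (norm_le_zero_iff.1 this)

/-- An orthogonal family can be extended by an element whose distance to the span is its absolute
value. -/
theorem IsOrthogonalOn.update [DecidableEq ι] {μ : ι → CInfty F} {I : Set ι}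
    (h : IsOrthogonalOn μ I) {j : ι} (hj : j ∉ I) {x : CInfty F}
    (hx : ∀ v ∈ Submodule.span F (μ '' I), ‖x‖ ≤ ‖v + x‖) :
    IsOrthogonalOn (Function.update μ j x) (insert j I) := by
  intro c hc i hi
  have hsupp : ((c.erase j).support : Set ι) ⊆ I := by
    intro i hi
    rw [Finsupp.support_erase, Finset.mem_coe, Finset.mem_erase] at hi
    exact (hc hi.2).resolve_left hi.1
  have hv : Finsupp.linearCombination F μ (c.erase j) ∈ Submodule.span F (μ '' I) :=
    (Finsupp.mem_span_image_iff_linearCombination F).2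
      ⟨_, (Finsupp.mem_supported _ _).2 hsupp, rfl⟩
  have e : Finsupp.linearCombination F (Function.update μ j x) c =
      Finsupp.linearCombination F μ (c.erase j) + c j • x := by
    conv_lhs => rw [← Finsupp.erase_add_single j c]
    rw [map_add, Finsupp.linearCombination_single, Function.update_self]
    congr 1
    simp only [Finsupp.linearCombination_apply, Finsupp.sum]
    refine Finset.sum_congr rfl fun i hi => ?_
    rw [Finsupp.support_erase, Finset.mem_erase] at hi
    rw [Function.update_of_ne hi.1]
  rw [e]
  rcases eq_or_ne i j with rfl | hij
  · rw [Function.update_self]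
    exact (le_max_right _ _).trans (max_norm_le_norm_add_smul hx hv hi)
  · rw [Function.update_of_ne hij]
    have h1 := h _ hsupp i (by rwa [Finsupp.erase_ne hij])
    by_cases hcj : c j = 0
    · rwa [hcj, zero_smul, add_zero]
    · exact h1.trans ((le_max_left _ _).trans (max_norm_le_norm_add_smul hx hv hcj))

theorem span_image_update [DecidableEq ι] {μ : ι → CInfty F} {I : Set ι} {j : ι} (hj : j ∉ I)
    (x : CInfty F) : Submodule.span F (Function.update μ j x '' insert j I) =
      Submodule.span F (μ '' I) ⊔ Submodule.span F {x} := by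
  have e : Function.update μ j x '' I = μ '' I :=
    Set.image_congr fun i hi => Function.update_of_ne (fun h : i = j => hj (h ▸ hi)) x μ
  rw [Set.image_insert_eq, Function.update_self, Submodule.span_insert, sup_comm, e]

/-- The number of elements in a disc of a lattice with an orthogonal basis. -/
theorem card_ball_add_one {V : FLattice F} {μ : ι → CInfty F} {I : Set ι}
    (h : IsOrthogonalOn μ I) (h0 : ∀ i, μ i ≠ 0) (hV : V.toSubmodule = Submodule.span F (μ '' I))
    {r : ℝ} (hr : 0 ≤ r) {T : Finset ι} (hT : ∀ i, i ∈ T ↔ i ∈ I ∧ ‖μ i‖ ≤ r) :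
    (V.ball r).card + 1 = Nat.card F ^ T.card := by
  classical
  have hTI : (T : Set ι) ⊆ I := fun i hi => ((hT i).1 hi).1
  have e : ∀ y, y ∈ V.ball r ↔ y ∈ Submodule.span F (μ '' (T : Set ι)) ∧ y ≠ 0 := by
    intro y
    rw [mem_ball_iff hr]
    refine and_congr_left fun _ => ⟨?_, fun hy => ?_⟩
    · rintro ⟨hy, hyr⟩
      rw [hV] at hy
      obtain ⟨c, hc, rfl⟩ := (Finsupp.mem_span_image_iff_linearCombination F).1 hy
      refine (Finsupp.mem_span_image_iff_linearCombination F).2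
        ⟨c, (Finsupp.mem_supported _ _).2 fun i hi => ?_, rfl⟩
      exact (hT i).2 ⟨(Finsupp.mem_supported _ _).1 hc hi,
        (h c ((Finsupp.mem_supported _ _).1 hc) i (Finsupp.mem_support_iff.1 hi)).trans hyr⟩
    · refine Submodule.span_le.2 ?_ hy
      rintro _ ⟨i, hi, rfl⟩
      refine ⟨?_, ((hT i).1 hi).2⟩
      rw [hV]
      exact Submodule.subset_span ⟨i, hTI hi, rfl⟩
  have hli := (h.mono hTI).linearIndepOn h0
  have hspan : Submodule.span F (μ '' (T : Set ι)) =
      Submodule.span F (Set.range fun i : (T : Set ι) => μ i) := by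
    rw [Set.image_eq_range]
  have : Module.Finite F (Submodule.span F (μ '' (T : Set ι))) :=
    Module.Finite.span_of_finite F (T.finite_toSet.image μ)
  rw [card_add_one_eq_natCard e, Module.natCard_eq_pow_finrank (K := F), hspan,
    finrank_span_eq_card hli]
  simp

end Orthogonal

/-- A successive minimum basis is orthogonal. -/
theorem IsSMB.isOrthogonalOn {Λ : FLattice F} {b : Module.Basis Λ.Idx F Λ.toSubmodule}
    (hb : Λ.IsSMB b) : IsOrthogonalOn (fun i => (b i : CInfty F)) Set.univ := by
  intro c _ i hi
  have hne : c.support.Nonempty := ⟨i, Finsupp.mem_support_iff.2 hi⟩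
  set m := c.support.max' hne
  have e : Finsupp.linearCombination F (fun i => (b i : CInfty F)) c =
      (Finsupp.linearCombination F b c : Λ.toSubmodule) := by
    have := Finsupp.apply_linearCombination F Λ.toSubmodule.subtype b c
    exact this.symm
  rw [e]
  refine (hb.monotone (c.support.le_max' i (Finsupp.mem_support_iff.2 hi))).trans (hb m _ ?_)
  rw [Module.Basis.mem_span_image, Module.Basis.repr_linearCombination]
  intro h
  exact lt_irrefl m (h (c.support.max'_mem hne))

/-- A lattice with an orthogonal basis that has the same absolute values as a successive minimum
basis of `Λ` is isospectral to `Λ`. -/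
theorem isospectral_of_isOrthogonalOn {Λ Λ' : FLattice F}
    {b : Module.Basis Λ.Idx F Λ.toSubmodule} (hb : Λ.IsSMB b) {μ : Λ.Idx → CInfty F}
    (hμ : IsOrthogonalOn μ Set.univ) (hμb : ∀ i, ‖μ i‖ = ‖(b i : CInfty F)‖)
    (hΛ' : Λ'.toSubmodule = Submodule.span F (Set.range μ)) : Λ.Isospectral Λ' := by
  have h0 : ∀ i, μ i ≠ 0 := fun i h => by
    have := hμb i
    rw [h, norm_zero, eq_comm, norm_eq_zero, Submodule.coe_eq_zero] at this
    exact b.ne_zero i this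
  have hli : LinearIndependent F μ := linearIndepOn_univ_iff.1 (hμ.linearIndepOn h0)
  let b₁ : Module.Basis Λ.Idx F Λ'.toSubmodule :=
    (Module.Basis.span hli).map (LinearEquiv.ofEq _ _ hΛ'.symm)
  have hb₁ : ∀ i, (b₁ i : CInfty F) = μ i := fun i => by
    simp [b₁, Module.Basis.span_apply]
  have hdim : Λ.dim = Λ'.dim := by
    rw [dim, dim, (b.equiv b₁ (Equiv.refl _)).rank_eq]
  let e : Λ.Idx ≃ Λ'.Idx := Equiv.subtypeEquivRight fun i => by rw [hdim]
  have hb₂ : Λ'.IsSMB (b₁.reindex e) := by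
    intro i x hx
    rw [Module.Basis.mem_span_image, Set.not_subset] at hx
    obtain ⟨j, hj, hji⟩ := hx
    have hij : e.symm i ≤ e.symm j := not_lt.1 hji
    have hj : b₁.repr x (e.symm j) ≠ 0 := by
      simpa [Module.Basis.repr_reindex_apply] using hj
    have h1 := hμ (b₁.repr x) (Set.subset_univ _) _ hj
    have h2 : Finsupp.linearCombination F μ (b₁.repr x) = (x : CInfty F) := by
      have h3 := Finsupp.apply_linearCombination F Λ'.toSubmodule.subtype b₁ (b₁.repr x)
      rw [b₁.linearCombination_repr] at h3
      have h4 : (Λ'.toSubmodule.subtype ∘ b₁ : Λ.Idx → CInfty F) = μ := funext hb₁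
      rw [h4] at h3
      exact h3.symm
    rw [Module.Basis.reindex_apply, hb₁, hμb]
    rw [h2, hμb] at h1
    exact (hb.monotone hij).trans h1
  funext i
  by_cases hi : 1 ≤ i ∧ (i : ℕ∞) ≤ Λ.dim
  · have h1 := hb.spec_eq ⟨i, hi⟩
    have h2 := hb₂.spec_eq (e ⟨i, hi⟩)
    rw [Module.Basis.reindex_apply, Equiv.symm_apply_apply, hb₁, hμb] at h2
    exact h1.trans h2.symm
  · rw [spec, dif_neg hi, spec, dif_neg (by rwa [hdim] at hi)]

theorem exists_finset_idx_le (Λ : FLattice F) {n : ℕ} (hn : (n : ℕ∞) ≤ Λ.dim) :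
    ∃ T : Finset Λ.Idx, (∀ i, i ∈ T ↔ i.1 ≤ n) ∧ T.card = n := by
  classical
  refine ⟨(Finset.Icc 1 n).subtype _, fun i => ?_, ?_⟩
  · rw [Finset.mem_subtype, Finset.mem_Icc]
    exact and_iff_right i.2.1
  · rw [Finset.card_subtype, Finset.filter_true_of_mem, Nat.card_Icc, Nat.add_sub_cancel]
    intro i hi
    rw [Finset.mem_Icc] at hi
    exact ⟨hi.1, le_trans (by exact_mod_cast hi.2) hn⟩

/-! ### Inseparable lattices -/

theorem isInseparable_of_alpha_eq_zero (Λ : FLattice F) {k : ℕ} (hk : (k : ℕ∞) < Λ.dim)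
    (h : Λ.alpha k = 0) : Λ.IsInseparable k := by
  have hk1 : 1 ≤ k := by
    refine Nat.one_le_iff_ne_zero.2 ?_
    rintro rfl
    exact one_ne_zero (Λ.alpha_zero.symm.trans h)
  have hk' : ((k + 1 : ℕ) : ℕ∞) ≤ Λ.dim := by
    exact_mod_cast Order.add_one_le_of_lt hk
  obtain ⟨b, hb⟩ := Λ.exists_isSMB
  let i₀ : Λ.Idx := ⟨k, hk1, hk.le⟩
  let i₁ : Λ.Idx := ⟨k + 1, by omega, hk'⟩
  refine ⟨hk1, hk, ?_⟩
  rw [hb.spec_eq i₀, hb.spec_eq i₁]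
  refine le_antisymm (hb.monotone (Nat.le_succ k)) ?_
  by_contra! hlt
  have hb0 : ∀ i, (b i : CInfty F) ≠ 0 := fun i => by simpa using b.ne_zero i
  have hr : 0 < ‖(b i₀ : CInfty F)‖ := norm_pos_iff.2 (hb0 i₀)
  obtain ⟨T, hT, hTk⟩ := Λ.exists_finset_idx_le hk.le
  have hspan : Λ.toSubmodule =
      Submodule.span F ((fun i => (b i : CInfty F)) '' Set.univ) := by
    have := congrArg (Submodule.map Λ.toSubmodule.subtype) b.span_eq
    rw [Submodule.map_span, Submodule.map_top, Submodule.range_subtype, ← Set.range_comp] at this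
    rw [Set.image_univ]
    exact this.symm
  have hcard := card_ball_add_one hb.isOrthogonalOn hb0 hspan hr.le (T := T) fun i => by
    rw [hT]
    refine ⟨fun hi => ⟨trivial, hb.monotone hi⟩, fun hi => ?_⟩
    by_contra! hki
    exact absurd ((hb.monotone (show i₁ ≤ i from hki)).trans hi.2) (not_le.2 hlt)
  rw [hTk] at hcard
  have := Λ.norm_alpha_eq hr hcard
  rw [h, norm_zero, zero_mul] at this
  exact (Λ.gaussNorm_pos hr).ne this

theorem exists_isospectral_alpha_eq_zero (Λ : FLattice F) {k : ℕ} (h : Λ.IsInseparable k) :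
    ∃ Λ' : FLattice F, Λ.Isospectral Λ' ∧ Λ'.alpha k = 0 := by
  classical
  obtain ⟨hk1, hk, hspec⟩ := h
  have hk' : ((k + 1 : ℕ) : ℕ∞) ≤ Λ.dim := by
    exact_mod_cast Order.add_one_le_of_lt hk
  obtain ⟨b, hb⟩ := Λ.exists_isSMB
  let i₀ : Λ.Idx := ⟨k, hk1, hk.le⟩
  let i₁ : Λ.Idx := ⟨k + 1, by omega, hk'⟩
  have hi₀₁ : i₀ < i₁ := Nat.lt_succ_self k
  rw [hb.spec_eq i₀, hb.spec_eq i₁] at hspec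
  obtain ⟨l, rfl⟩ : ∃ l, k = l + 1 := ⟨k - 1, by omega⟩
  set β : Λ.Idx → CInfty F := fun i => (b i : CInfty F)
  have hβ0 : ∀ i, β i ≠ 0 := fun i => by simpa [β] using b.ne_zero i
  set r := ‖β i₀‖
  have hr : 0 < r := norm_pos_iff.2 (hβ0 i₀)
  have hβ := hb.isOrthogonalOn
  -- the part of the basis with absolute value `r` that is replaced
  have hJfin : {i : Λ.Idx | i₀ ≤ i ∧ ‖β i‖ = r}.Finite := by
    refine Set.Finite.of_finite_image ((Λ.finite_ball r).subset ?_)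
      (f := β) ((Subtype.val_injective.comp b.injective).injOn)
    rintro _ ⟨i, hi, rfl⟩
    exact ⟨(b i).2, hi.2.le⟩
  set J := hJfin.toFinset
  have hJ : ∀ i, i ∈ J ↔ i₀ ≤ i ∧ ‖β i‖ = r := fun i => by simp [J]
  set I₀ : Set Λ.Idx := {i | i ∉ J}
  have key : ∀ T : Finset Λ.Idx, T ⊆ J → ∃ (μ : Λ.Idx → CInfty F) (V : FLattice F),
      (∀ i, ‖μ i‖ = ‖β i‖) ∧ IsOrthogonalOn μ (I₀ ∪ T) ∧
      V.toSubmodule = Submodule.span F (μ '' (I₀ ∪ T)) ∧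
      ‖V.alpha l‖ * r ^ Nat.card F ^ l = V.gaussNorm r ∧
      (T.Nonempty → ‖V.alpha (l + 1)‖ * r ^ Nat.card F ^ (l + 1) = V.gaussNorm r) := by
    intro T
    induction T using Finset.induction_on with
    | empty =>
      intro _
      rw [Finset.coe_empty, Set.union_empty]
      have hle : Submodule.span F (β '' I₀) ≤ Λ.toSubmodule := by
        rw [Submodule.span_le]
        rintro _ ⟨i, _, rfl⟩
        exact (b i).2
      let V : FLattice F := ⟨Submodule.span F (β '' I₀), fun R =>
        (Λ.finite_ball R).subset fun x hx => ⟨hle hx.1, hx.2⟩⟩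
      have hI₀ := hβ.mono (Set.subset_univ I₀)
      refine ⟨β, V, fun _ => rfl, hI₀, rfl, ?_, fun h => absurd h (by simp)⟩
      obtain ⟨T, hT, hTl⟩ := Λ.exists_finset_idx_le (n := l)
        (le_trans (by exact_mod_cast l.le_succ) hk.le)
      have hcard := card_ball_add_one (V := V) hI₀ hβ0 rfl hr.le (T := T) fun i => by
        rw [hT]
        constructor
        · intro hi
          have hlt : i < i₀ := Nat.lt_succ_of_le hi
          exact ⟨fun hiJ => absurd ((hJ i).1 hiJ).1 (not_le.2 hlt), hb.monotone hlt.le⟩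
        · rintro ⟨hiJ, hir⟩
          by_contra! hli
          have hi : i₀ ≤ i := hli
          exact hiJ ((hJ i).2 ⟨hi, le_antisymm hir (hb.monotone hi)⟩)
      rw [hTl] at hcard
      exact V.norm_alpha_eq hr hcard
    | insert j T hj ih =>
      intro hT
      obtain ⟨μ, V, hμ, horth, hV, hl, -⟩ :=
        ih fun i hi => hT (Finset.mem_insert_of_mem hi)
      have hjJ := hT (Finset.mem_insert_self j T)
      have hjI : j ∉ I₀ ∪ T := by
        rintro (h | h)
        · exact h hjJ
        · exact hj h
      obtain ⟨x, V', hx, hdist, hV', hl', hl''⟩ :=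
        V.exists_generic_adjoin hr (y := β i₀) rfl hl
      have e : I₀ ∪ ((insert j T : Finset Λ.Idx) : Set Λ.Idx) = insert j (I₀ ∪ T) := by
        rw [Finset.coe_insert, Set.union_insert]
      refine ⟨Function.update μ j x, V', fun i => ?_, ?_, ?_, hl', fun _ => hl''⟩
      · rcases eq_or_ne i j with rfl | hij
        · rw [Function.update_self, hx, ((hJ i).1 hjJ).2]
        · rw [Function.update_of_ne hij, hμ]
      · rw [e]
        refine horth.update hjI ?_
        rwa [← hV, hx]
      · rw [e, span_image_update hjI, ← hV, hV']
  obtain ⟨μ, V, hμ, horth, hV, hl, hl'⟩ := key (J.erase i₁) (J.erase_subset i₁)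
  have hi₀J : i₀ ∈ J := (hJ _).2 ⟨le_rfl, rfl⟩
  have hi₁J : i₁ ∈ J := (hJ _).2 ⟨hi₀₁.le, hspec.symm⟩
  have hi₁I : i₁ ∉ I₀ ∪ (J.erase i₁ : Finset Λ.Idx) := by
    rintro (h | h)
    · exact h hi₁J
    · exact Finset.notMem_erase _ _ h
  have huniv : insert i₁ (I₀ ∪ (J.erase i₁ : Finset Λ.Idx)) = Set.univ := by
    refine Set.eq_univ_of_forall fun i => ?_
    by_cases h1 : i = i₁
    · exact Or.inl h1
    by_cases h2 : i ∈ J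
    · exact Or.inr (Or.inr (Finset.mem_coe.2 (Finset.mem_erase.2 ⟨h1, h2⟩)))
    · exact Or.inr (Or.inl h2)
  obtain ⟨x, Λ', hx, hdist, hΛ', hα⟩ := V.exists_adjoin_alpha_eq_zero hr hl
    (hl' ⟨i₀, Finset.mem_erase.2 ⟨hi₀₁.ne, hi₀J⟩⟩)
  refine ⟨Λ', isospectral_of_isOrthogonalOn hb (μ := Function.update μ i₁ x) ?_ (fun i => ?_) ?_,
    hα⟩
  · rw [← huniv]
    refine horth.update hi₁I ?_
    rwa [← hV, hx]
  · rcases eq_or_ne i i₁ with rfl | hij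
    · rw [Function.update_self, hx]
      exact hspec
    · rw [Function.update_of_ne hij, hμ]
  · rw [← Set.image_univ, ← huniv, span_image_update hi₁I, ← hV, hΛ']

end FLattice

theorem proposition1p11 {F : Type*} [Field F] [Finite F] (Λ : FLattice F) (k : ℕ) :
    ((k : ℕ∞) < Λ.dim → Λ.alpha k = 0 → Λ.IsInseparable k) ∧
      (Λ.IsInseparable k → ∃ Λ' : FLattice F, Λ.Isospectral Λ' ∧ Λ'.alpha k = 0) :=
  ⟨Λ.isInseparable_of_alpha_eq_zero, Λ.exists_isospectral_alpha_eq_zero⟩
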